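/- Let $(B,g_B)$ and $(F,g_F)$ be smooth pseudo-Riemannian manifolds (without boundary) of dimensions $m$ and $k$, and let $c,w\in C^\infty(B)$ be strictly positive functions. Equip $B\times F$ with the $[c,w]$-base conformal warped product metric $g=c^2g_B+w^2g_F$, that is, $g=(c\circ\pi)^2\,\pi^*g_B+(w\circ\pi)^2\,\sigma^*g_F$, where $\pi:B\times F\to B$ and $\sigma:B\times F\to F$ are the projections. Write $\mathrm{Ric}$, $\mathrm{Ric}_B$, $\mathrm{Ric}_F$ for the Ricci tensors of $g$, $g_B$, $g_F$ (with $\mathrm{Ric}(Y,Z)=\operatorname{trace}(X\mapsto R(X,Y)Z)$, $R(X,Y)Z=\nabla_X\nabla_YZ-\nabla_Y\nabla_XZ-\nabla_{[X,Y]}Z$). For $v\in C^\infty(B)$ let $\nabla^Bv$ be its gradient, $\mathrm{H}_B^v(X,Y)=XYv-(\nabla^B_XY)v$ its Hessian and $\Delta_Bv$ the $g_B$-trace of $\mathrm{H}_B^v$. Let $\mathcal L(B)$ and $\mathcal L(F)$ be the sets of lifts to $B\times F$ of vector fields on $B$ and on $F$: the lift of a vector field on one factor projects to that field on this factor and to $0$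 on the other. Then, with the functions and tensors of $B$ (of $F$) evaluated at the $B$-component (the $F$-component) of the point, the following hold. 1. On $\mathcal L(B)\times\mathcal L(B)$: $$\mathrm{Ric}=\mathrm{Ric}_B-\Big[(m-2)\frac1c\mathrm{H}_B^c+k\frac1w\mathrm{H}_B^w\Big]+2(m-2)\frac1{c^2}\,dc\otimes dc+k\frac1{wc}\,[dc\otimes dw+dw\otimes dc]$$ $$\qquad-\Big[(m-3)\frac{g_B(\nabla^Bc,\nabla^Bc)}{c^2}+\frac{\Delta_Bc}{c}+k\frac{g_B(\nabla^Bw,\nabla^Bc)}{wc}\Big]g_B .$$ 2. On $\mathcal L(B)\times\mathcal L(F)$ and on $\mathcal L(F)\times\mathcal L(B)$: $\ \mathrm{Ric}=0$. 3. On $\mathcal L(F)\times\mathcal L(F)$: $$\mathrm{Ric}=\mathrm{Ric}_F-\frac{w^2}{c^2}\Big[(m-2)\frac{g_B(\nabla^Bw,\nabla^Bc)}{wc}+\frac{\Delta_Bw}{w}+(k-1)\frac{g_B(\nabla^Bw,\nabla^Bw)}{w^2}\Big]g_F .$$ -/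

import Mathlib

open Bundle Manifold
open scoped ContDiff

set_option maxSynthPendingDepth 3

noncomputable section

/-! ### Metric geometry in a coordinate domain

`E` is a finite-dimensional coordinate space, `G : E → E →L[ℝ] E →L[ℝ] ℝ` is a field of symmetric
nondegenerate bilinear forms (the metric coefficients `g_ij`), differentiable as often as needed
near the point `y` under consideration. -/

/-- The bilinear form `(v, w) ↦ A(Dv, Dw)`. -/
def pullbackForm {V W : Type*} [TopologicalSpace V] [AddCommGroup V] [Module ℝ V]
    [TopologicalSpace W] [AddCommGroup W] [Module ℝ W]
    (A : V →L[ℝ] V →L[ℝ] ℝ) (D : W →L[ℝ] V) : W →L[ℝ] W →L[ℝ] ℝ :=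
  ContinuousLinearMap.precomp ℝ D ∘L A ∘L D

theorem pullbackForm_apply {V W : Type*} [TopologicalSpace V] [AddCommGroup V] [Module ℝ V]
    [TopologicalSpace W] [AddCommGroup W] [Module ℝ W]
    (A : V →L[ℝ] V →L[ℝ] ℝ) (D : W →L[ℝ] V) (v w : W) :
    pullbackForm A D v w = A (D v) (D w) := rfl

namespace LocalMetric

variable {E : Type*} [NormedAddCommGroup E] [NormedSpace ℝ E]

/-- The Koszul form `(u, v, z) ↦ D_u G(v, z) + D_v G(u, z) - D_z G(u, v)`. -/
def koszul (G : E → E →L[ℝ] E →L[ℝ] ℝ) (y : E) : E →L[ℝ] E →L[ℝ] E →L[ℝ] ℝ :=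
  fderiv ℝ G y + (fderiv ℝ G y).flip -
    (ContinuousLinearMap.flipₗᵢ ℝ E E ℝ).toContinuousLinearEquiv.toContinuousLinearMap ∘L
      (fderiv ℝ G y).flip

theorem koszul_apply (G : E → E →L[ℝ] E →L[ℝ] ℝ) (y u v z : E) :
    koszul G y u v z = fderiv ℝ G y u v z + fderiv ℝ G y v u z - fderiv ℝ G y z u v := rfl

/-- The Levi-Civita connection of `G` in coordinates: `christoffel G y u v = Γ_y(u, v)` is the
vector with `G_y(Γ_y(u, v), z) = (D_u G(v, z) + D_v G(u, z) - D_z G(u, v)) / 2` for all `z`,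
so that `∇_X Y = DY(X) + Γ(X, Y)`. -/
def christoffel (G : E → E →L[ℝ] E →L[ℝ] ℝ) (y : E) : E →L[ℝ] E →L[ℝ] E :=
  (1 / 2 : ℝ) • (ContinuousLinearMap.compL ℝ E (E →L[ℝ] ℝ) E (G y).inverse ∘L koszul G y)

theorem christoffel_apply (G : E → E →L[ℝ] E →L[ℝ] ℝ) (y u v : E) :
    christoffel G y u v = (1 / 2 : ℝ) • (G y).inverse (koszul G y u v) := rfl

/-- The curvature endomorphism `u ↦ R(u, v)w`, where
`R(X, Y)Z = ∇_X ∇_Y Z - ∇_Y ∇_X Z - ∇_[X,Y] Z`. -/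
def curvature (G : E → E →L[ℝ] E →L[ℝ] ℝ) (y v w : E) : E →L[ℝ] E :=
  ((fderiv ℝ (christoffel G) y).flip v).flip w - (fderiv ℝ (christoffel G) y v).flip w +
    (christoffel G y).flip (christoffel G y v w) -
    (christoffel G y v) ∘L ((christoffel G y).flip w)

theorem curvature_apply (G : E → E →L[ℝ] E →L[ℝ] ℝ) (y u v w : E) :
    curvature G y v w u =
      fderiv ℝ (christoffel G) y u v w - fderiv ℝ (christoffel G) y v u w +
        christoffel G y u (christoffel G y v w) - christoffel G y v (christoffel G y u w) := rfl

/-- The Ricci tensor `Ric(v, w) = trace (u ↦ R(u, v)w)`. -/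
def ricci (G : E → E →L[ℝ] E →L[ℝ] ℝ) (y v w : E) : ℝ :=
  LinearMap.trace ℝ E (curvature G y v w : E →ₗ[ℝ] E)

/-- The Hessian `H(u, v) = D²f(u, v) - Df(Γ(u, v))`, that is `X(Yf) - (∇_X Y)f`. -/
def hessian (G : E → E →L[ℝ] E →L[ℝ] ℝ) (f : E → ℝ) (y : E) : E →L[ℝ] E →L[ℝ] ℝ :=
  fderiv ℝ (fderiv ℝ f) y -
    ContinuousLinearMap.compL ℝ E E ℝ (fderiv ℝ f y) ∘L christoffel G y

theorem hessian_apply (G : E → E →L[ℝ] E →L[ℝ] ℝ) (f : E → ℝ) (y u v : E) :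
    hessian G f y u v = fderiv ℝ (fderiv ℝ f) y u v - fderiv ℝ f y (christoffel G y u v) := rfl

/-- The Laplace-Beltrami operator: the metric trace `g^ij H_ij` of the Hessian. -/
def laplacian (G : E → E →L[ℝ] E →L[ℝ] ℝ) (f : E → ℝ) (y : E) : ℝ :=
  LinearMap.trace ℝ E (((G y).inverse ∘L hessian G f y : E →L[ℝ] E) : E →ₗ[ℝ] E)

end LocalMetric

/-! ### Pseudo-Riemannian manifolds -/

section Manifold

variable {E : Type*} [NormedAddCommGroup E] [NormedSpace ℝ E]
  {H : Type*} [TopologicalSpace H] (I : ModelWithCorners ℝ E H)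
  (M : Type*) [TopologicalSpace M] [ChartedSpace H M] [IsManifold I ∞ M]

/-- A smooth pseudo-Riemannian metric on `M`: a smooth field of symmetric nondegenerate bilinear
forms on the tangent spaces, of arbitrary signature. -/
structure PseudoRiemannianMetric where
  /-- The bilinear form on each tangent space. -/
  inner (x : M) : TangentSpace I x →L[ℝ] TangentSpace I x →L[ℝ] ℝ
  symm (x : M) (v w : TangentSpace I x) : inner x v w = inner x w v
  nondegenerate (x : M) (v : TangentSpace I x) (hv : ∀ w, inner x v w = 0) : v = 0
  contMDiff : ContMDiff I (I.prod 𝓘(ℝ, E →L[ℝ] E →L[ℝ] ℝ)) ∞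
    (fun x ↦ TotalSpace.mk' (E →L[ℝ] E →L[ℝ] ℝ)
      (E := fun x : M ↦ TangentSpace I x →L[ℝ] TangentSpace I x →L[ℝ] ℝ) x (inner x))

end Manifold

namespace PseudoRiemannianMetric

section Tensors

variable {E : Type*} [NormedAddCommGroup E] [NormedSpace ℝ E]
  {H : Type*} [TopologicalSpace H] {I : ModelWithCorners ℝ E H}
  {M : Type*} [TopologicalSpace M] [ChartedSpace H M] [IsManifold I ∞ M]

/-- The coefficients of `g` in the preferred chart `φ` at `p`: the pullback of `g` under `φ⁻¹`.
(For a manifold without boundary `Set.range I` is the whole space.) -/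
def inChart (g : PseudoRiemannianMetric I M) (p : M) (y : E) : E →L[ℝ] E →L[ℝ] ℝ :=
  pullbackForm (g.inner ((extChartAt I p).symm y))
    (mfderivWithin 𝓘(ℝ, E) I (extChartAt I p).symm (Set.range I) y)

/- The preferred chart at `p` is the one through which Mathlib identifies `TangentSpace I p`
with the coordinate space `E`; the tensors below are therefore computed in that chart. -/

/-- The Ricci tensor of a pseudo-Riemannian manifold without boundary. -/
def ricci (g : PseudoRiemannianMetric I M) (p : M) (v w : TangentSpace I p) : ℝ :=
  LocalMetric.ricci (g.inChart p) (extChartAt I p p) v w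

/-- The Hessian of a smooth function. -/
def hessian (g : PseudoRiemannianMetric I M) (f : M → ℝ) (p : M) (v w : TangentSpace I p) : ℝ :=
  LocalMetric.hessian (g.inChart p) (f ∘ (extChartAt I p).symm) (extChartAt I p p) v w

/-- The Laplace-Beltrami operator, the metric trace of the Hessian. -/
def laplacian (g : PseudoRiemannianMetric I M) (f : M → ℝ) (p : M) : ℝ :=
  LocalMetric.laplacian (g.inChart p) (f ∘ (extChartAt I p).symm) (extChartAt I p p)

/-- The gradient: the vector `∇f` with `g(∇f, v) = df(v)`. -/
def gradient (g : PseudoRiemannianMetric I M) (f : M → ℝ) (p : M) : TangentSpace I p :=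
  (g.inner p).inverse (mvfderiv I f p)

end Tensors

section Pullback

variable {E : Type*} [NormedAddCommGroup E] [NormedSpace ℝ E]
  {H : Type*} [TopologicalSpace H] {I : ModelWithCorners ℝ E H}
  {M : Type*} [TopologicalSpace M] [ChartedSpace H M] [IsManifold I ∞ M]
  {E' : Type*} [NormedAddCommGroup E'] [NormedSpace ℝ E']
  {H' : Type*} [TopologicalSpace H'] {I' : ModelWithCorners ℝ E' H'}
  {N : Type*} [TopologicalSpace N] [ChartedSpace H' N] [IsManifold I' ∞ N]

theorem hom_real_trivialization_apply {x₀ x : M}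
    (hx : x ∈ (trivializationAt E (fun x : M ↦ TangentSpace I x) x₀).baseSet)
    (φ : TangentSpace I x →L[ℝ] ℝ) (v : E) :
    (trivializationAt (E →L[ℝ] ℝ) (fun x : M ↦ TangentSpace I x →L[ℝ] ℝ) x₀).continuousLinearMapAt
      ℝ x φ v = φ ((trivializationAt E (fun x : M ↦ TangentSpace I x) x₀).symmL ℝ x v) := by
  rw [Trivialization.continuousLinearMapAt_apply, Trivialization.linearMapAt_apply, if_pos]
  · simp [hom_trivializationAt_apply, ContinuousLinearMap.inCoordinates]
  · rw [hom_trivializationAt_baseSet]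
    exact ⟨hx, Set.mem_univ _⟩

theorem contDiff_pullbackForm : ContDiff ℝ ∞ (fun p : (E' →L[ℝ] E' →L[ℝ] ℝ) × (E →L[ℝ] E') ↦
    pullbackForm p.1 p.2) := by
  have : (fun p : (E' →L[ℝ] E' →L[ℝ] ℝ) × (E →L[ℝ] E') ↦ pullbackForm p.1 p.2) =
      fun p ↦ ((ContinuousLinearMap.compL ℝ E E' ℝ).flip p.2) ∘L (p.1 ∘L p.2) := rfl
  rw [this]
  fun_prop

/-- The pullback `f^* g` of a metric under a smooth map is a smooth field of bilinear forms. -/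
theorem contMDiff_pullback (g : PseudoRiemannianMetric I' N) {f : M → N}
    (hf : ContMDiff I I' ∞ f) :
    ContMDiff I (I.prod 𝓘(ℝ, E →L[ℝ] E →L[ℝ] ℝ)) ∞
      (fun x ↦ TotalSpace.mk' (E →L[ℝ] E →L[ℝ] ℝ)
        (E := fun x : M ↦ TangentSpace I x →L[ℝ] TangentSpace I x →L[ℝ] ℝ) x
        (pullbackForm (g.inner (f x)) (mfderiv I I' f x))) := by
  intro x₀
  rw [contMDiffAt_hom_bundle]
  refine ⟨contMDiffAt_id, ?_⟩
  have h1 := ((contMDiffAt_hom_bundle _).1 ((g.contMDiff.comp hf) x₀)).2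
  have h2 : ContMDiffAt I 𝓘(ℝ, E →L[ℝ] E') ∞
      (inTangentCoordinates I I' id f (mfderiv I I' f) x₀) x₀ :=
    (hf x₀).mfderiv_const (by simp)
  have h3 : ContMDiffAt I 𝓘(ℝ, E →L[ℝ] E →L[ℝ] ℝ) ∞ (fun x ↦
      pullbackForm (ContinuousLinearMap.inCoordinates E' (fun x : N ↦ TangentSpace I' x)
        (E' →L[ℝ] ℝ) (fun x : N ↦ TangentSpace I' x →L[ℝ] ℝ) (f x₀) (f x) (f x₀) (f x)
        (g.inner (f x))) (inTangentCoordinates I I' id f (mfderiv I I' f) x₀ x)) x₀ := by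
    have e := contDiff_pullbackForm (E := E) (E' := E')
    have h4 : ContMDiffAt I 𝓘(ℝ, E' →L[ℝ] E' →L[ℝ] ℝ) ∞ (fun x ↦
        ContinuousLinearMap.inCoordinates E' (fun x : N ↦ TangentSpace I' x)
        (E' →L[ℝ] ℝ) (fun x : N ↦ TangentSpace I' x →L[ℝ] ℝ) (f x₀) (f x) (f x₀) (f x)
        (g.inner (f x))) x₀ := h1
    have h5 := h4.prodMk_space h2
    have h6 := e.comp_contMDiffAt h5
    exact h6
  refine h3.congr_of_eventuallyEq ?_
  have hs : ∀ᶠ x in nhds x₀, x ∈ (trivializationAt E (fun x : M ↦ TangentSpace I x) x₀).baseSet :=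
    (trivializationAt E (fun x : M ↦ TangentSpace I x) x₀).open_baseSet.mem_nhds
      (FiberBundle.mem_baseSet_trivializationAt' x₀)
  have ht : ∀ᶠ x in nhds x₀,
      f x ∈ (trivializationAt E' (fun x : N ↦ TangentSpace I' x) (f x₀)).baseSet :=
    hf.continuous.continuousAt
      ((trivializationAt E' (fun x : N ↦ TangentSpace I' x) (f x₀)).open_baseSet.mem_nhds
        (FiberBundle.mem_baseSet_trivializationAt' (f x₀)))
  filter_upwards [hs, ht] with x hx hy
  ext u v
  simp only [pullbackForm_apply, inTangentCoordinates, ContinuousLinearMap.inCoordinates,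
     ContinuousLinearMap.comp_apply, id]
  rw [hom_real_trivialization_apply hx, hom_real_trivialization_apply hy, pullbackForm_apply,
    Trivialization.symmL_continuousLinearMapAt _ hy, Trivialization.symmL_continuousLinearMapAt _ hy]

end Pullback

section BaseConformalWarpedProduct

variable {E : Type*} [NormedAddCommGroup E] [NormedSpace ℝ E]
  {H : Type*} [TopologicalSpace H] {I : ModelWithCorners ℝ E H}
  {B : Type*} [TopologicalSpace B] [ChartedSpace H B] [IsManifold I ∞ B]
  {E' : Type*} [NormedAddCommGroup E'] [NormedSpace ℝ E']
  {H' : Type*} [TopologicalSpace H'] {I' : ModelWithCorners ℝ E' H'}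
  {F : Type*} [TopologicalSpace F] [ChartedSpace H' F] [IsManifold I' ∞ F]

/-- The `[c, w]`-base conformal warped product metric `c² g_B + w² g_F` on `B × F`, that is
`(c ∘ π)² π^* g_B + (w ∘ π)² σ^* g_F` with `π`, `σ` the projections onto `B` and `F`. -/
def baseConformalWarped (gB : PseudoRiemannianMetric I B) (gF : PseudoRiemannianMetric I' F)
    (c w : B → ℝ) (hc : ContMDiff I 𝓘(ℝ, ℝ) ∞ c) (hw : ContMDiff I 𝓘(ℝ, ℝ) ∞ w)
    (hc_pos : ∀ x, 0 < c x) (hw_pos : ∀ x, 0 < w x) :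
    PseudoRiemannianMetric (I.prod I') (B × F) where
  inner z :=
    (c z.1) ^ 2 • pullbackForm (gB.inner z.1) (mfderiv (I.prod I') I Prod.fst z) +
      (w z.1) ^ 2 • pullbackForm (gF.inner z.2) (mfderiv (I.prod I') I' Prod.snd z)
  symm z u v := by
    simp only [add_apply, smul_apply, pullbackForm_apply]
    rw [gB.symm, gF.symm]
  nondegenerate z v hv := by
    have hv' : ∀ u : E × E', (c z.1) ^ 2 * gB.inner z.1 (v : E × E').1 u.1 +
        (w z.1) ^ 2 * gF.inner z.2 (v : E × E').2 u.2 = 0 := by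
      intro u
      have h := hv u
      rw [mfderiv_fst, mfderiv_snd] at h
      exact h
    have h1 : (v : E × E').1 = 0 := by
      refine gB.nondegenerate z.1 _ fun a ↦ ?_
      have h := hv' (a, 0)
      have h0 : gF.inner z.2 (v : E × E').2 (0 : E') = 0 := map_zero (gF.inner z.2 (v : E × E').2)
      rw [h0, mul_zero, add_zero] at h
      exact (mul_eq_zero.1 h).resolve_left (pow_pos (hc_pos z.1) 2).ne'
    have h2 : (v : E × E').2 = 0 := by
      refine gF.nondegenerate z.2 _ fun a ↦ ?_
      have h := hv' (0, a)
      have h0 : gB.inner z.1 (v : E × E').1 (0 : E) = 0 := map_zero (gB.inner z.1 (v : E × E').1)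
      rw [h0, mul_zero, zero_add] at h
      exact (mul_eq_zero.1 h).resolve_left (pow_pos (hw_pos z.1) 2).ne'
    exact Prod.ext h1 h2
  contMDiff := by
    have hc' : ContMDiff (I.prod I') 𝓘(ℝ, ℝ) ∞ (fun z : B × F ↦ (c z.1) ^ 2) :=
      (hc.comp contMDiff_fst).pow 2
    have hw' : ContMDiff (I.prod I') 𝓘(ℝ, ℝ) ∞ (fun z : B × F ↦ (w z.1) ^ 2) :=
      (hw.comp contMDiff_fst).pow 2
    exact (hc'.smul_section (gB.contMDiff_pullback contMDiff_fst)).add_section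
      (hw'.smul_section (gF.contMDiff_pullback contMDiff_snd))

end BaseConformalWarpedProduct

end PseudoRiemannianMetric

/-! ### Lifts of vector fields to a product -/

section Lifts

variable {E : Type*} [NormedAddCommGroup E] [NormedSpace ℝ E]
  {H : Type*} [TopologicalSpace H] {I : ModelWithCorners ℝ E H}
  {B : Type*} [TopologicalSpace B] [ChartedSpace H B]
  {E' : Type*} [NormedAddCommGroup E'] [NormedSpace ℝ E']
  {H' : Type*} [TopologicalSpace H'] {I' : ModelWithCorners ℝ E' H'}
  {F : Type*} [TopologicalSpace F] [ChartedSpace H' F]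

/-- The lift to `B × F` of a vector field on `B`: the vector field that projects to `X` on `B`
and to `0` on `F`. -/
def liftBase (X : ∀ x : B, TangentSpace I x) (z : B × F) : TangentSpace (I.prod I') z :=
  ((X z.1, 0) : E × E')

/-- The lift to `B × F` of a vector field on `F`: the vector field that projects to `0` on `B`
and to `V` on `F`. -/
def liftFiber (V : ∀ y : F, TangentSpace I' y) (z : B × F) : TangentSpace (I.prod I') z :=
  ((0, V z.2) : E × E')

end Lifts

end

/-! Put c = exp φ and w = exp ψ, so that dc/c and dw/w become dφ and dψ. The Levi-Civita connection
of exp(2φ) g_B + exp(2ψ) g_F is then the product connection plus terms that are algebraic in dφ, dψ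
and the gradients; the only exponential left is exp(2ψ - 2φ), where the fibers bend into the base.
Uniqueness in the Koszul formula confirms this guess (`WarpedRegularAt.christoffel_warped`) without
inverting the product metric. Differentiating the connection gives the curvature. Derivatives of the
metric, of df and of ∇f are rewritten through Γ and the Hessian (`RegularAt.fderiv_apply`,
`fderiv_fderiv_apply`, `RegularAt.hasFDerivAt_gradient`); the chart-dependent terms then cancel and
tensors remain. A trace on E × E' sees only the two diagonal blocks of u ↦ R(u, v)w (`trace_prod`).
Each block is a sum of a factor curvature, multiples of the identity (trace m or k), rank-one maps α
⊗ s (trace α(s)) and G⁻¹H (trace the Laplacian). Substituting φ = log c and ψ = log w yields the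
stated coefficients. On the manifold, the chart at (p, q) is the product chart, the coefficients of
g near its center are such a warped metric, and Ricci depends only on the germ of the metric. -/

noncomputable section

namespace LocalMetric

open Filter Topology

/-! ### Levi-Civita connection, gradient and Hessian in coordinates. -/

section

variable {E : Type*} [NormedAddCommGroup E] [NormedSpace ℝ E]

/-- Near `y`, the field `G` is twice continuously differentiable and symmetric, and it is
nondegenerate at `y`. -/
structure RegularAt (G : E → E →L[ℝ] E →L[ℝ] ℝ) (y : E) : Prop where
  contDiffAt : ContDiffAt ℝ 2 G y
  symm : ∀ᶠ x in 𝓝 y, ∀ u v, G x u v = G x v u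
  isInvertible : (G y).IsInvertible

/-- The gradient `G⁻¹ df` in coordinates. -/
def gradient (G : E → E →L[ℝ] E →L[ℝ] ℝ) (f : E → ℝ) (y : E) : E :=
  (G y).inverse (fderiv ℝ f y)

/-- An injective linear map from E to its dual, which has the same finite dimension, is bijective.
-/
theorem isInvertible_of_nondegenerate [FiniteDimensional ℝ E] (A : E →L[ℝ] E →L[ℝ] ℝ)
    (hA : ∀ v, (∀ w, A v w = 0) → v = 0) : A.IsInvertible := by
  have hinj : Function.Injective (A : E →ₗ[ℝ] E →L[ℝ] ℝ) := by
    rw [← LinearMap.ker_eq_bot, LinearMap.ker_eq_bot']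
    intro v hv
    refine hA v fun w ↦ ?_
    have : A v = 0 := hv
    simp [this]
  have hdim : Module.finrank ℝ E = Module.finrank ℝ (E →L[ℝ] ℝ) := by
    rw [← (LinearMap.toContinuousLinearMap (𝕜 := ℝ) (E := E) (F' := ℝ)).finrank_eq]
    exact (Subspace.dual_finrank_eq (K := ℝ) (V := E)).symm
  refine ⟨(LinearEquiv.ofInjectiveOfFinrankEq _ hinj hdim).toContinuousLinearEquiv, ?_⟩
  ext v w
  rfl

variable {G : E → E →L[ℝ] E →L[ℝ] ℝ} {y : E}

/-- Pointwise identities get differentiated later, so they must hold on a neighborhood. Invertible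
operators form an open set. -/
theorem RegularAt.eventually [CompleteSpace E] (h : RegularAt G y) :
    ∀ᶠ x in 𝓝 y, RegularAt G x := by
  have hinv : ∀ᶠ x in 𝓝 y, (G x).IsInvertible := by
    obtain ⟨e, he⟩ := h.isInvertible
    have := ContinuousLinearEquiv.nhds e
    rw [he] at this
    exact h.contDiffAt.continuousAt this
  filter_upwards [h.contDiffAt.eventually (by simp), h.symm.eventually_nhds, hinv] with x h1 h2 h3
  exact ⟨h1, h2, h3⟩

theorem RegularAt.differentiableAt (h : RegularAt G y) : DifferentiableAt ℝ G y :=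
  h.contDiffAt.differentiableAt (by simp)

theorem RegularAt.differentiableAt_fderiv (h : RegularAt G y) :
    DifferentiableAt ℝ (fderiv ℝ G) y :=
  (h.contDiffAt.fderiv_right (m := 1) (by norm_num)).differentiableAt (by simp)

theorem RegularAt.hasFDerivAt_apply (h : RegularAt G y) (a b : E) :
    HasFDerivAt (fun x ↦ G x a b) (((fderiv ℝ G y).flip a).flip b) y :=
  (h.differentiableAt.hasFDerivAt.clm_apply (hasFDerivAt_const a y)).clm_apply
    (hasFDerivAt_const b y) |>.congr_fderiv (by ext; simp)

theorem RegularAt.fderiv_symm (h : RegularAt G y) (e u v : E) :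
    fderiv ℝ G y e u v = fderiv ℝ G y e v u := by
  have h1 := h.hasFDerivAt_apply u v
  have h2 : (fun x ↦ G x u v) =ᶠ[𝓝 y] fun x ↦ G x v u := by
    filter_upwards [h.symm] with x hx using hx u v
  exact congrArg (fun L : E →L[ℝ] ℝ ↦ L e)
    (h1.unique ((h.hasFDerivAt_apply v u).congr_of_eventuallyEq h2))

theorem inner_christoffel (h : (G y).IsInvertible) (u v z : E) :
    G y (christoffel G y u v) z = 1 / 2 * koszul G y u v z := by
  rw [christoffel_apply, map_smul, h.self_apply_inverse]
  rfl

/-- This lets a candidate for Γ(u, v) be checked by pairing it with test vectors, so the inverse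
metric never has to be computed. -/
theorem christoffel_eq_of_inner (h : (G y).IsInvertible) {u v s : E}
    (hs : ∀ z, G y s z = 1 / 2 * koszul G y u v z) : christoffel G y u v = s := by
  refine h.injective (ContinuousLinearMap.ext fun z ↦ ?_)
  rw [inner_christoffel h, hs]

theorem RegularAt.christoffel_symm (h : RegularAt G y) (u v : E) :
    christoffel G y u v = christoffel G y v u := by
  refine christoffel_eq_of_inner h.isInvertible fun z ↦ ?_
  rw [inner_christoffel h.isInvertible, koszul_apply, koszul_apply, h.fderiv_symm z u v]
  ring

/-- The Levi-Civita connection is metric. -/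
theorem RegularAt.fderiv_apply (h : RegularAt G y) (e a b : E) :
    fderiv ℝ G y e a b = G y (christoffel G y e a) b + G y a (christoffel G y e b) := by
  -- In the sum of the two Koszul forms the D_a G and D_b G terms cancel in pairs.
  rw [h.symm.self_of_nhds a, inner_christoffel h.isInvertible, inner_christoffel h.isInvertible,
    koszul_apply, koszul_apply, h.fderiv_symm e b a, h.fderiv_symm a e b, h.fderiv_symm b e a]
  ring

theorem RegularAt.differentiableAt_inverse [CompleteSpace E] (h : RegularAt G y) :
    DifferentiableAt ℝ (fun x ↦ (G x).inverse) y := by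
  have h1 : DifferentiableAt ℝ (ContinuousLinearMap.inverse (R := ℝ) (M := E) (M₂ := E →L[ℝ] ℝ))
      (G y) := (h.isInvertible.contDiffAt_map_inverse (n := 1)).differentiableAt (by simp)
  exact h1.comp y h.differentiableAt

theorem RegularAt.differentiableAt_christoffel [CompleteSpace E] (h : RegularAt G y) :
    DifferentiableAt ℝ (christoffel G) y := by
  have h1 := h.differentiableAt_inverse
  have h2 := h.differentiableAt_fderiv
  have h3 : DifferentiableAt ℝ (fun x ↦ (fderiv ℝ G x).flip) y :=
    (ContinuousLinearMap.flipₗᵢ ℝ E E (E →L[ℝ] ℝ)).toContinuousLinearEquiv.differentiableAt.comp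
      y h2
  have h4 : DifferentiableAt ℝ (koszul G) y :=
    (h2.add h3).sub ((differentiableAt_const _).clm_comp h3)
  exact (((ContinuousLinearMap.compL ℝ E (E →L[ℝ] ℝ) E).differentiableAt.comp y h1).clm_comp
    h4).const_smul (1 / 2 : ℝ)

theorem RegularAt.hasFDerivAt_christoffel [CompleteSpace E] (h : RegularAt G y) (a b : E) :
    HasFDerivAt (fun x ↦ christoffel G x a b) (((fderiv ℝ (christoffel G) y).flip a).flip b) y :=
  (h.differentiableAt_christoffel.hasFDerivAt.clm_apply (hasFDerivAt_const a y)).clm_apply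
    (hasFDerivAt_const b y) |>.congr_fderiv (by ext; simp)

section Functions

variable {f : E → ℝ}

theorem inner_gradient (h : (G y).IsInvertible) (v : E) :
    G y (gradient G f y) v = fderiv ℝ f y v := by
  rw [gradient, h.self_apply_inverse]

theorem hasFDerivAt_fderiv_apply (hf : ContDiffAt ℝ 2 f y) (a : E) :
    HasFDerivAt (fun x ↦ fderiv ℝ f x a) ((fderiv ℝ (fderiv ℝ f) y).flip a) y :=
  (((hf.fderiv_right (m := 1) (by norm_num)).differentiableAt (by simp)).hasFDerivAt.clm_apply
    (hasFDerivAt_const a y)).congr_fderiv (by ext; simp)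

/-- Trades the chart-dependent second derivative for the Hessian, so that the Γ term can cancel in
the curvature. -/
theorem fderiv_fderiv_apply (e a : E) :
    fderiv ℝ (fderiv ℝ f) y e a = hessian G f y e a + fderiv ℝ f y (christoffel G y e a) := by
  rw [hessian_apply, sub_add_cancel]

theorem RegularAt.hessian_symm (h : RegularAt G y) (hf : ContDiffAt ℝ 2 f y) (u v : E) :
    hessian G f y u v = hessian G f y v u := by
  have := (hf.isSymmSndFDerivAt (by simp)).eq u v
  rw [hessian_apply, hessian_apply, h.christoffel_symm u v, this]

/-- The covariant derivative of the gradient is the Hessian. -/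
theorem RegularAt.hasFDerivAt_gradient [CompleteSpace E] (h : RegularAt G y)
    (hf : ContDiffAt ℝ 2 f y) :
    HasFDerivAt (gradient G f) ((G y).inverse ∘L hessian G f y -
      (christoffel G y).flip (gradient G f y)) y := by
  have hdf : DifferentiableAt ℝ (fderiv ℝ f) y :=
    (hf.fderiv_right (m := 1) (by norm_num)).differentiableAt (by simp)
  have hd : DifferentiableAt ℝ (gradient G f) y := h.differentiableAt_inverse.clm_apply hdf
  refine hd.hasFDerivAt.congr_fderiv ?_
  ext e
  refine h.isInvertible.injective (ContinuousLinearMap.ext fun z ↦ ?_)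
  -- Differentiate the identity G(∇f, ·) = df; metric compatibility turns the derivative of G into Γ
  -- terms.
  have h1 : (fun x ↦ G x (gradient G f x)) =ᶠ[𝓝 y] fderiv ℝ f := by
    filter_upwards [h.eventually] with x hx
    ext v
    exact inner_gradient hx.isInvertible v
  have h2 := ((h.differentiableAt.hasFDerivAt.clm_apply hd.hasFDerivAt).congr_of_eventuallyEq
    h1.symm).unique hdf.hasFDerivAt
  have h3 := congrArg (fun L : E →L[ℝ] E →L[ℝ] ℝ ↦ L e z) h2
  simp only [add_apply, ContinuousLinearMap.comp_apply, ContinuousLinearMap.flip_apply,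
    h.fderiv_apply, inner_gradient h.isInvertible] at h3
  simp only [sub_apply, ContinuousLinearMap.comp_apply, ContinuousLinearMap.flip_apply, map_sub,
    h.isInvertible.self_apply_inverse, hessian_apply]
  linarith

end Functions

end

/-! ### The warped metric on a product and its connection. -/

section

variable {E : Type*} [NormedAddCommGroup E] [NormedSpace ℝ E]
  {E' : Type*} [NormedAddCommGroup E'] [NormedSpace ℝ E']

/-- The warped metric `exp(2φ) GB + exp(2ψ) GF` on a product of coordinate domains. -/
def warped (GB : E → E →L[ℝ] E →L[ℝ] ℝ) (GF : E' → E' →L[ℝ] E' →L[ℝ] ℝ) (φ ψ : E → ℝ)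
    (z : E × E') : E × E' →L[ℝ] E × E' →L[ℝ] ℝ :=
  Real.exp (2 * φ z.1) • pullbackForm (GB z.1) (ContinuousLinearMap.fst ℝ E E') +
    Real.exp (2 * ψ z.1) • pullbackForm (GF z.2) (ContinuousLinearMap.snd ℝ E E')

variable {GB : E → E →L[ℝ] E →L[ℝ] ℝ} {GF : E' → E' →L[ℝ] E' →L[ℝ] ℝ} {φ ψ : E → ℝ} {x : E} {y : E'}

theorem warped_apply (z u v : E × E') : warped GB GF φ ψ z u v =
    Real.exp (2 * φ z.1) * GB z.1 u.1 v.1 + Real.exp (2 * ψ z.1) * GF z.2 u.2 v.2 := rfl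

/-- The hypotheses under which the curvature of a warped metric is computed at a point. -/
structure WarpedRegularAt (GB : E → E →L[ℝ] E →L[ℝ] ℝ) (GF : E' → E' →L[ℝ] E' →L[ℝ] ℝ)
    (φ ψ : E → ℝ) (x : E) (y : E') : Prop where
  base : RegularAt GB x
  fiber : RegularAt GF y
  conformal : ContDiffAt ℝ 2 φ x
  warping : ContDiffAt ℝ 2 ψ x

theorem WarpedRegularAt.eventually [CompleteSpace E] [CompleteSpace E']
    (h : WarpedRegularAt GB GF φ ψ x y) :
    ∀ᶠ z in 𝓝 (x, y), WarpedRegularAt GB GF φ ψ z.1 z.2 := by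
  rw [nhds_prod_eq]
  filter_upwards [(h.base.eventually.and ((h.conformal.eventually (by simp)).and
    (h.warping.eventually (by simp)))).prod_mk h.fiber.eventually] with z hz
  exact ⟨hz.1.1, hz.2, hz.1.2.1, hz.1.2.2⟩

theorem WarpedRegularAt.of_pos {C W : E → ℝ} (hB : RegularAt GB x) (hF : RegularAt GF y)
    (hC : ContDiffAt ℝ 2 C x)
    (hW : ContDiffAt ℝ 2 W x) (hC0 : 0 < C x) (hW0 : 0 < W x) :
    WarpedRegularAt GB GF (fun x ↦ Real.log (C x)) (fun x ↦ Real.log (W x)) x y where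
  base := hB
  fiber := hF
  conformal := hC.log hC0.ne'
  warping := hW.log hW0.ne'

theorem contDiffAt_warped {n : ℕ∞} {z : E × E'} (h1 : ContDiffAt ℝ n GB z.1)
    (h2 : ContDiffAt ℝ n GF z.2) (h3 : ContDiffAt ℝ n φ z.1) (h4 : ContDiffAt ℝ n ψ z.1) :
    ContDiffAt ℝ n (warped GB GF φ ψ) z := by
  have a1 : ContDiffAt ℝ n (fun z : E × E' ↦ GB z.1) z := h1.comp z contDiffAt_fst
  have a2 : ContDiffAt ℝ n (fun z : E × E' ↦ GF z.2) z := h2.comp z contDiffAt_snd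
  have a3 : ContDiffAt ℝ n (fun z : E × E' ↦ φ z.1) z := h3.comp z contDiffAt_fst
  have a4 : ContDiffAt ℝ n (fun z : E × E' ↦ ψ z.1) z := h4.comp z contDiffAt_fst
  unfold warped pullbackForm
  fun_prop

theorem WarpedRegularAt.isInvertible [FiniteDimensional ℝ E] [FiniteDimensional ℝ E']
    (h : WarpedRegularAt GB GF φ ψ x y) : (warped GB GF φ ψ (x, y)).IsInvertible := by
  refine isInvertible_of_nondegenerate _ fun v hv ↦ Prod.ext ?_ ?_
  · refine h.base.isInvertible.injective (ContinuousLinearMap.ext fun a ↦ ?_)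
    have := hv (a, 0)
    simpa [warped_apply] using this
  · refine h.fiber.isInvertible.injective (ContinuousLinearMap.ext fun a ↦ ?_)
    have := hv (0, a)
    simpa [warped_apply] using this

theorem WarpedRegularAt.regularAt [FiniteDimensional ℝ E] [FiniteDimensional ℝ E']
    (h : WarpedRegularAt GB GF φ ψ x y) : RegularAt (warped GB GF φ ψ) (x, y) where
  contDiffAt := contDiffAt_warped (n := 2) h.base.contDiffAt h.fiber.contDiffAt h.conformal h.warping
  symm := by
    have : CompleteSpace E := FiniteDimensional.complete ℝ E
    have : CompleteSpace E' := FiniteDimensional.complete ℝ E'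
    filter_upwards [h.eventually] with z hz u v
    rw [warped_apply, warped_apply, hz.base.symm.self_of_nhds, hz.fiber.symm.self_of_nhds]
  isInvertible := h.isInvertible

theorem WarpedRegularAt.fderiv_warped [FiniteDimensional ℝ E] [FiniteDimensional ℝ E']
    (h : WarpedRegularAt GB GF φ ψ x y) (e u v : E × E') :
    fderiv ℝ (warped GB GF φ ψ) (x, y) e u v =
      Real.exp (2 * φ x) * (2 * fderiv ℝ φ x e.1 * GB x u.1 v.1 + fderiv ℝ GB x e.1 u.1 v.1) +
      Real.exp (2 * ψ x) * (2 * fderiv ℝ ψ x e.1 * GF y u.2 v.2 + fderiv ℝ GF y e.2 u.2 v.2) := by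
  have h1 := h.regularAt.hasFDerivAt_apply u v
  have hφ : HasFDerivAt φ (fderiv ℝ φ x) ((x, y) : E × E').1 :=
    (h.conformal.differentiableAt (by simp)).hasFDerivAt
  have hψ : HasFDerivAt ψ (fderiv ℝ ψ x) ((x, y) : E × E').1 :=
    (h.warping.differentiableAt (by simp)).hasFDerivAt
  have hB : HasFDerivAt (fun x ↦ GB x u.1 v.1) _ ((x, y) : E × E').1 :=
    h.base.hasFDerivAt_apply u.1 v.1
  have hF : HasFDerivAt (fun x ↦ GF x u.2 v.2) _ ((x, y) : E × E').2 :=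
    h.fiber.hasFDerivAt_apply u.2 v.2
  have fs : HasFDerivAt (Prod.fst : E × E' → E) (ContinuousLinearMap.fst ℝ E E') (x, y) := hasFDerivAt_fst
  have sn : HasFDerivAt (Prod.snd : E × E' → E') (ContinuousLinearMap.snd ℝ E E') (x, y) := hasFDerivAt_snd
  have h2 := (((hφ.comp _ fs).const_mul 2).exp.mul (hB.comp _ fs)).add
    (((hψ.comp _ fs).const_mul 2).exp.mul (hF.comp _ sn))
  have h3 := congrArg (fun L : E × E' →L[ℝ] ℝ ↦ L e) (h1.unique h2)
  simp only [add_apply, smul_apply, smul_eq_mul, ContinuousLinearMap.comp_apply,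
    ContinuousLinearMap.flip_apply, Function.comp_apply, ContinuousLinearMap.coe_fst',
    ContinuousLinearMap.coe_snd'] at h3
  rw [h3]
  ring

/-- The base component of the Levi-Civita connection of a warped metric. -/
def baseChristoffel (GB : E → E →L[ℝ] E →L[ℝ] ℝ) (GF : E' → E' →L[ℝ] E' →L[ℝ] ℝ) (φ ψ : E → ℝ)
    (u v : E × E') (z : E × E') : E :=
  christoffel GB z.1 u.1 v.1 + fderiv ℝ φ z.1 u.1 • v.1 + fderiv ℝ φ z.1 v.1 • u.1 -
    GB z.1 u.1 v.1 • gradient GB φ z.1 -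
    (Real.exp (2 * ψ z.1 - 2 * φ z.1) * GF z.2 u.2 v.2) • gradient GB ψ z.1

/-- The fiber component of the Levi-Civita connection of a warped metric. -/
def fiberChristoffel (GF : E' → E' →L[ℝ] E' →L[ℝ] ℝ) (ψ : E → ℝ)
    (u v : E × E') (z : E × E') : E' :=
  christoffel GF z.2 u.2 v.2 + fderiv ℝ ψ z.1 u.1 • v.2 + fderiv ℝ ψ z.1 v.1 • u.2

theorem WarpedRegularAt.christoffel_warped [FiniteDimensional ℝ E] [FiniteDimensional ℝ E']
    (h : WarpedRegularAt GB GF φ ψ x y) (u v : E × E') :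
    christoffel (warped GB GF φ ψ) (x, y) u v =
      (baseChristoffel GB GF φ ψ u v (x, y), fiberChristoffel GF ψ u v (x, y)) := by
  refine christoffel_eq_of_inner h.isInvertible fun z ↦ ?_
  rw [koszul_apply, h.fderiv_warped, h.fderiv_warped, h.fderiv_warped, warped_apply]
  simp only [baseChristoffel, fiberChristoffel, map_add, map_sub, map_smul, add_apply, sub_apply,
    smul_apply, smul_eq_mul, inner_gradient h.base.isInvertible,
    inner_christoffel h.base.isInvertible, inner_christoffel h.fiber.isInvertible, koszul_apply]
  -- Pairing the base component with exp(2φ) g_B turns its factor exp(2ψ - 2φ) into the weight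
  -- exp(2ψ) of the fiber metric.
  have hexp : Real.exp (2 * φ x) * Real.exp (2 * ψ x - 2 * φ x) = Real.exp (2 * ψ x) := by
    rw [← Real.exp_add]
    congr 1
    ring
  rw [← hexp]
  ring

end

/-! ### Derivative of the warped connection; traces on a product. -/

section

variable {E : Type*} [NormedAddCommGroup E] [NormedSpace ℝ E]
  {E' : Type*} [NormedAddCommGroup E'] [NormedSpace ℝ E']
  [FiniteDimensional ℝ E] [FiniteDimensional ℝ E']
  {GB : E → E →L[ℝ] E →L[ℝ] ℝ} {GF : E' → E' →L[ℝ] E' →L[ℝ] ℝ} {φ ψ : E → ℝ} {x : E} {y : E'}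

/-- Apart from the derivative of the connection of g_B itself, everything is expressed through Γ,
Hessians and gradients, ready to cancel against the quadratic Γ terms of the curvature. -/
theorem WarpedRegularAt.fderiv_baseChristoffel (h : WarpedRegularAt GB GF φ ψ x y)
    (s u v : E × E') :
    (fderiv ℝ (christoffel (warped GB GF φ ψ)) (x, y) s u v).1 =
      fderiv ℝ (christoffel GB) x s.1 u.1 v.1 +
      (hessian GB φ x s.1 u.1 + fderiv ℝ φ x (christoffel GB x s.1 u.1)) • v.1 +
      (hessian GB φ x s.1 v.1 + fderiv ℝ φ x (christoffel GB x s.1 v.1)) • u.1 -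
      (GB x (christoffel GB x s.1 u.1) v.1 + GB x u.1 (christoffel GB x s.1 v.1)) •
        gradient GB φ x -
      GB x u.1 v.1 • ((GB x).inverse (hessian GB φ x s.1) -
        christoffel GB x s.1 (gradient GB φ x)) -
      (Real.exp (2 * ψ x - 2 * φ x) * ((2 * fderiv ℝ ψ x s.1 - 2 * fderiv ℝ φ x s.1) *
        GF y u.2 v.2 +
        (GF y (christoffel GF y s.2 u.2) v.2 + GF y u.2 (christoffel GF y s.2 v.2)))) •
        gradient GB ψ x -
      (Real.exp (2 * ψ x - 2 * φ x) * GF y u.2 v.2) • ((GB x).inverse (hessian GB ψ x s.1) -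
        christoffel GB x s.1 (gradient GB ψ x)) := by
  have : CompleteSpace E := FiniteDimensional.complete ℝ E
  have : CompleteSpace E' := FiniteDimensional.complete ℝ E'
  have h1 := h.regularAt.hasFDerivAt_christoffel u v
  have h2 : (fun z ↦ (christoffel (warped GB GF φ ψ) z u v).1) =ᶠ[𝓝 (x, y)]
      baseChristoffel GB GF φ ψ u v := by
    filter_upwards [h.eventually] with z hz
    rw [hz.christoffel_warped]
  have hφ : HasFDerivAt φ (fderiv ℝ φ x) ((x, y) : E × E').1 :=
    (h.conformal.differentiableAt (by simp)).hasFDerivAt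
  have hψ : HasFDerivAt ψ (fderiv ℝ ψ x) ((x, y) : E × E').1 :=
    (h.warping.differentiableAt (by simp)).hasFDerivAt
  have fs : HasFDerivAt (Prod.fst : E × E' → E) (ContinuousLinearMap.fst ℝ E E') (x, y) :=
    hasFDerivAt_fst
  have sn : HasFDerivAt (Prod.snd : E × E' → E') (ContinuousLinearMap.snd ℝ E E') (x, y) :=
    hasFDerivAt_snd
  have hΓ : HasFDerivAt (fun x ↦ christoffel GB x u.1 v.1) _ ((x, y) : E × E').1 :=
    h.base.hasFDerivAt_christoffel u.1 v.1
  have hB : HasFDerivAt (fun x ↦ GB x u.1 v.1) _ ((x, y) : E × E').1 :=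
    h.base.hasFDerivAt_apply u.1 v.1
  have hF : HasFDerivAt (fun x ↦ GF x u.2 v.2) _ ((x, y) : E × E').2 :=
    h.fiber.hasFDerivAt_apply u.2 v.2
  have hu : HasFDerivAt (fun x ↦ fderiv ℝ φ x u.1) _ ((x, y) : E × E').1 :=
    hasFDerivAt_fderiv_apply h.conformal u.1
  have hv : HasFDerivAt (fun x ↦ fderiv ℝ φ x v.1) _ ((x, y) : E × E').1 :=
    hasFDerivAt_fderiv_apply h.conformal v.1
  have hP : HasFDerivAt (gradient GB φ) _ ((x, y) : E × E').1 :=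
    h.base.hasFDerivAt_gradient h.conformal
  have hQ : HasFDerivAt (gradient GB ψ) _ ((x, y) : E × E').1 :=
    h.base.hasFDerivAt_gradient h.warping
  have h3 := (((((hΓ.comp _ fs).add ((hu.comp _ fs).smul_const v.1)).add
    ((hv.comp _ fs).smul_const u.1)).sub ((hB.comp _ fs).smul (hP.comp _ fs))).sub
    (((((hψ.comp _ fs).const_mul 2).sub ((hφ.comp _ fs).const_mul 2)).exp.mul
      (hF.comp _ sn)).smul (hQ.comp _ fs)))
  have h4 := congrArg (fun L : E × E' →L[ℝ] E ↦ L s)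
    (((hasFDerivAt_fst.comp _ h1).congr_of_eventuallyEq h2.symm).unique h3)
  simp only [add_apply, sub_apply, smul_apply, smul_eq_mul, ContinuousLinearMap.comp_apply,
    ContinuousLinearMap.flip_apply, Function.comp_apply, ContinuousLinearMap.coe_fst',
    ContinuousLinearMap.coe_snd', ContinuousLinearMap.smulRight_apply, h.base.fderiv_apply,
    h.fiber.fderiv_apply, fderiv_fderiv_apply (G := GB), Pi.mul_apply, Pi.sub_apply] at h4
  rw [h4]
  module

theorem WarpedRegularAt.fderiv_fiberChristoffel (h : WarpedRegularAt GB GF φ ψ x y)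
    (s u v : E × E') :
    (fderiv ℝ (christoffel (warped GB GF φ ψ)) (x, y) s u v).2 =
      fderiv ℝ (christoffel GF) y s.2 u.2 v.2 +
      (hessian GB ψ x s.1 u.1 + fderiv ℝ ψ x (christoffel GB x s.1 u.1)) • v.2 +
      (hessian GB ψ x s.1 v.1 + fderiv ℝ ψ x (christoffel GB x s.1 v.1)) • u.2 := by
  have : CompleteSpace E := FiniteDimensional.complete ℝ E
  have : CompleteSpace E' := FiniteDimensional.complete ℝ E'
  have h1 := h.regularAt.hasFDerivAt_christoffel u v
  have h2 : (fun z ↦ (christoffel (warped GB GF φ ψ) z u v).2) =ᶠ[𝓝 (x, y)]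
      fiberChristoffel GF ψ u v := by
    filter_upwards [h.eventually] with z hz
    rw [hz.christoffel_warped]
  have fs : HasFDerivAt (Prod.fst : E × E' → E) (ContinuousLinearMap.fst ℝ E E') (x, y) :=
    hasFDerivAt_fst
  have sn : HasFDerivAt (Prod.snd : E × E' → E') (ContinuousLinearMap.snd ℝ E E') (x, y) :=
    hasFDerivAt_snd
  have hΓ : HasFDerivAt (fun y ↦ christoffel GF y u.2 v.2) _ ((x, y) : E × E').2 :=
    h.fiber.hasFDerivAt_christoffel u.2 v.2
  have hu : HasFDerivAt (fun x ↦ fderiv ℝ ψ x u.1) _ ((x, y) : E × E').1 :=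
    hasFDerivAt_fderiv_apply h.warping u.1
  have hv : HasFDerivAt (fun x ↦ fderiv ℝ ψ x v.1) _ ((x, y) : E × E').1 :=
    hasFDerivAt_fderiv_apply h.warping v.1
  have h3 := ((hΓ.comp _ sn).add ((hu.comp _ fs).smul_const v.2)).add
    ((hv.comp _ fs).smul_const u.2)
  have h4 := congrArg (fun L : E × E' →L[ℝ] E' ↦ L s)
    (((hasFDerivAt_snd.comp _ h1).congr_of_eventuallyEq h2.symm).unique h3)
  simp only [add_apply, ContinuousLinearMap.comp_apply,
    ContinuousLinearMap.flip_apply, ContinuousLinearMap.coe_fst',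
    ContinuousLinearMap.coe_snd', ContinuousLinearMap.smulRight_apply,
    fderiv_fderiv_apply (G := GB)] at h4
  exact h4

/-- Split T by precomposing with the two coordinate projectors; cyclicity of the trace then moves
each projection to the other side. -/
theorem trace_prod (T : E × E' →L[ℝ] E × E') :
    LinearMap.trace ℝ (E × E') (T : E × E' →ₗ[ℝ] E × E') =
      LinearMap.trace ℝ E ((ContinuousLinearMap.fst ℝ E E' ∘L T ∘L ContinuousLinearMap.inl ℝ E E' :
        E →L[ℝ] E) : E →ₗ[ℝ] E) +
      LinearMap.trace ℝ E' ((ContinuousLinearMap.snd ℝ E E' ∘L T ∘L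
        ContinuousLinearMap.inr ℝ E E' : E' →L[ℝ] E') : E' →ₗ[ℝ] E') := by
  have h1 : (T : E × E' →ₗ[ℝ] E × E') =
      ((T : E × E' →ₗ[ℝ] E × E') ∘ₗ LinearMap.inl ℝ E E') ∘ₗ LinearMap.fst ℝ E E' +
      ((T : E × E' →ₗ[ℝ] E × E') ∘ₗ LinearMap.inr ℝ E E') ∘ₗ LinearMap.snd ℝ E E' := by
    refine LinearMap.ext fun z ↦ ?_
    simp [← map_add]
  rw [h1, map_add]
  exact congrArg₂ _ (LinearMap.trace_comp_comm' (LinearMap.fst ℝ E E') _)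
    (LinearMap.trace_comp_comm' (LinearMap.snd ℝ E E') _)

end

section

variable {E : Type*} [NormedAddCommGroup E] [NormedSpace ℝ E]
  {E' : Type*} [NormedAddCommGroup E'] [NormedSpace ℝ E']
  [FiniteDimensional ℝ E] [FiniteDimensional ℝ E']
  {GB : E → E →L[ℝ] E →L[ℝ] ℝ} {GF : E' → E' →L[ℝ] E' →L[ℝ] ℝ} {φ ψ : E → ℝ} {x : E} {y : E'}

/-! Blocks of the curvature of a warped metric. -/

/-- With all arguments in the base, ψ drops out: this is the curvature of the conformal metric
exp(2φ) g_B. -/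
theorem WarpedRegularAt.curvature_base_base_fst (h : WarpedRegularAt GB GF φ ψ x y) (a v w : E) :
    (curvature (warped GB GF φ ψ) (x, y) (v, 0) (w, 0) (a, 0)).1 =
      curvature GB x v w a +
      (hessian GB φ x w a - fderiv ℝ φ x w * fderiv ℝ φ x a +
        fderiv ℝ φ x (gradient GB φ x) * GB x w a) • v -
      (hessian GB φ x v w - fderiv ℝ φ x v * fderiv ℝ φ x w +
        fderiv ℝ φ x (gradient GB φ x) * GB x v w) • a -
      GB x v w • (GB x).inverse (hessian GB φ x a) +
      GB x w a • (GB x).inverse (hessian GB φ x v) +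
      (GB x v w * fderiv ℝ φ x a - fderiv ℝ φ x v * GB x w a) • gradient GB φ x := by
  have sG := h.base.symm.self_of_nhds
  rw [curvature_apply, curvature_apply, h.christoffel_warped, h.christoffel_warped,
    h.christoffel_warped, h.christoffel_warped]
  simp only [Prod.fst_add, Prod.fst_sub, h.fderiv_baseChristoffel, baseChristoffel,
    fiberChristoffel, map_zero, map_add, map_sub, map_smul, smul_zero, add_zero, smul_eq_mul,
    mul_zero, zero_smul, sub_zero]
  -- Once symmetric arguments are put in a common order, the Γ terms outside `curvature GB` cancel.
  rw [sG a (gradient GB φ x), sG v (gradient GB φ x), inner_gradient h.base.isInvertible,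
    inner_gradient h.base.isInvertible, h.base.christoffel_symm a v,
    h.base.hessian_symm h.conformal a w, h.base.hessian_symm h.conformal a v, sG a w, sG a v,
    sG (christoffel GB x v a) w]
  module

/-- The scalar is -exp(-ψ) times the Hessian of exp ψ for the conformal metric exp(2φ) g_B, so its
trace only brings in the factor k. -/
theorem WarpedRegularAt.curvature_base_base_snd (h : WarpedRegularAt GB GF φ ψ x y) (t : E')
    (v w : E) :
    (curvature (warped GB GF φ ψ) (x, y) (v, 0) (w, 0) (0, t)).2 =
      (fderiv ℝ ψ x v * fderiv ℝ φ x w + fderiv ℝ φ x v * fderiv ℝ ψ x w -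
        GB x v w * fderiv ℝ ψ x (gradient GB φ x) - hessian GB ψ x v w -
        fderiv ℝ ψ x v * fderiv ℝ ψ x w) • t := by
  rw [curvature_apply, h.christoffel_warped, h.christoffel_warped,
    h.christoffel_warped, h.christoffel_warped]
  simp only [Prod.snd_add, Prod.snd_sub, h.fderiv_fiberChristoffel, baseChristoffel,
    fiberChristoffel, map_zero, map_add, map_sub, map_smul, smul_zero, add_zero, smul_eq_mul,
    zero_apply, mul_zero, zero_smul, sub_zero]
  module

/-- Parity governs the four mixed blocks: the base component of R needs an even number of fiber
arguments, the fiber component an odd number, and the diagonal blocks here have the wrong count. -/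
theorem WarpedRegularAt.curvature_base_fiber_fst (h : WarpedRegularAt GB GF φ ψ x y) (a v : E)
    (w : E') : (curvature (warped GB GF φ ψ) (x, y) (v, 0) (0, w) (a, 0)).1 = 0 := by
  rw [curvature_apply, h.christoffel_warped, h.christoffel_warped,
    h.christoffel_warped, h.christoffel_warped]
  simp only [Prod.fst_add, Prod.fst_sub, h.fderiv_baseChristoffel, baseChristoffel,
    fiberChristoffel, map_zero, map_add, map_smul, smul_zero, add_zero, smul_eq_mul,
    zero_apply, mul_zero, zero_smul, sub_zero]

theorem WarpedRegularAt.curvature_base_fiber_snd (h : WarpedRegularAt GB GF φ ψ x y) (t : E')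
    (v : E) (w : E') : (curvature (warped GB GF φ ψ) (x, y) (v, 0) (0, w) (0, t)).2 = 0 := by
  rw [curvature_apply, h.christoffel_warped, h.christoffel_warped,
    h.christoffel_warped, h.christoffel_warped]
  simp only [Prod.snd_add, Prod.snd_sub, h.fderiv_fiberChristoffel, baseChristoffel,
    fiberChristoffel, map_zero, map_add, map_sub, map_smul, smul_zero, add_zero, smul_eq_mul,
    zero_apply, mul_zero, zero_smul, sub_zero]
  module

theorem WarpedRegularAt.curvature_fiber_base_fst (h : WarpedRegularAt GB GF φ ψ x y) (a w : E)
    (v : E') : (curvature (warped GB GF φ ψ) (x, y) (0, v) (w, 0) (a, 0)).1 = 0 := by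
  rw [curvature_apply, h.christoffel_warped, h.christoffel_warped,
    h.christoffel_warped, h.christoffel_warped]
  simp only [Prod.fst_add, Prod.fst_sub, h.fderiv_baseChristoffel, baseChristoffel,
    fiberChristoffel, map_zero, map_add, map_sub, map_smul, smul_zero, add_zero, smul_eq_mul,
    zero_apply, mul_zero, zero_smul, sub_zero]

theorem WarpedRegularAt.curvature_fiber_base_snd (h : WarpedRegularAt GB GF φ ψ x y) (t : E')
    (w : E) (v : E') : (curvature (warped GB GF φ ψ) (x, y) (0, v) (w, 0) (0, t)).2 = 0 := by
  rw [curvature_apply, h.christoffel_warped, h.christoffel_warped,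
    h.christoffel_warped, h.christoffel_warped]
  simp only [Prod.snd_add, Prod.snd_sub, h.fderiv_fiberChristoffel, baseChristoffel,
    fiberChristoffel, map_zero, map_add, map_smul, smul_zero, add_zero, smul_eq_mul,
    zero_apply, mul_zero, zero_smul, sub_zero]
  -- What survives is dψ(w)(Γ_F(t, v) - Γ_F(v, t)), which vanishes because the connection is
  -- torsion-free.
  rw [h.fiber.christoffel_symm v t]
  module

theorem WarpedRegularAt.curvature_fiber_fiber_fst (h : WarpedRegularAt GB GF φ ψ x y) (a : E)
    (v w : E') :
    (curvature (warped GB GF φ ψ) (x, y) (0, v) (0, w) (a, 0)).1 =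
      -(Real.exp (2 * ψ x - 2 * φ x) * GF y v w) •
        ((fderiv ℝ ψ x a - fderiv ℝ φ x a) • gradient GB ψ x +
          (GB x).inverse (hessian GB ψ x a) + fderiv ℝ φ x (gradient GB ψ x) • a -
          fderiv ℝ ψ x a • gradient GB φ x) := by
  have sG := h.base.symm.self_of_nhds
  rw [curvature_apply, h.christoffel_warped, h.christoffel_warped,
    h.christoffel_warped, h.christoffel_warped]
  simp only [Prod.fst_add, Prod.fst_sub, h.fderiv_baseChristoffel, baseChristoffel,
    fiberChristoffel, map_zero, map_smul, map_neg, smul_zero, add_zero, zero_add,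
    smul_eq_mul, zero_apply, mul_zero, zero_smul,
    sub_zero, zero_sub]
  rw [sG a (gradient GB ψ x), inner_gradient h.base.isInvertible]
  module

/-- The Gauss equation of the leaf {x} × F: it is homothetic to F and totally umbilic, since the
fiber-fiber term of the connection is g_F times a multiple of ∇ψ. -/
theorem WarpedRegularAt.curvature_fiber_fiber_snd (h : WarpedRegularAt GB GF φ ψ x y)
    (t v w : E') :
    (curvature (warped GB GF φ ψ) (x, y) (0, v) (0, w) (0, t)).2 =
      curvature GF y v w t - (Real.exp (2 * ψ x - 2 * φ x) * fderiv ℝ ψ x (gradient GB ψ x)) •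
        (GF y v w • t - GF y w t • v) := by
  have sG := h.fiber.symm.self_of_nhds
  rw [curvature_apply, curvature_apply, h.christoffel_warped, h.christoffel_warped,
    h.christoffel_warped, h.christoffel_warped]
  simp only [Prod.snd_add, Prod.snd_sub, h.fderiv_fiberChristoffel, baseChristoffel,
    fiberChristoffel, map_zero, map_smul, map_neg, smul_zero, add_zero,
    smul_eq_mul, zero_apply, mul_zero, zero_smul,
    sub_zero, zero_sub]
  rw [sG t w]
  module

end

/-! ### Calculus of logarithms and the Ricci tensor of a warped metric. -/

section

variable {E : Type*} [NormedAddCommGroup E] [NormedSpace ℝ E]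

section Logarithm

variable {G : E → E →L[ℝ] E →L[ℝ] ℝ} {f : E → ℝ} {x : E}

theorem fderiv_log (hf : ContDiffAt ℝ 2 f x) (h0 : f x ≠ 0) (v : E) :
    fderiv ℝ (fun x ↦ Real.log (f x)) x v = fderiv ℝ f x v / f x := by
  rw [fderiv.log (hf.differentiableAt (by simp)) h0, smul_apply, smul_eq_mul]
  ring

theorem gradient_log (hf : ContDiffAt ℝ 2 f x) (h0 : f x ≠ 0) :
    gradient G (fun x ↦ Real.log (f x)) x = (f x)⁻¹ • gradient G f x := by
  rw [gradient, fderiv.log (hf.differentiableAt (by simp)) h0, map_smul, gradient]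

theorem hessian_log (hf : ContDiffAt ℝ 2 f x) (h0 : f x ≠ 0) :
    hessian G (fun x ↦ Real.log (f x)) x = (f x)⁻¹ • hessian G f x -
      (f x ^ 2)⁻¹ • (fderiv ℝ f x).smulRight (fderiv ℝ f x) := by
  have h1 : fderiv ℝ (fun x ↦ Real.log (f x)) =ᶠ[𝓝 x] fun x ↦ (f x)⁻¹ • fderiv ℝ f x := by
    filter_upwards [hf.eventually (by simp), hf.continuousAt.eventually_ne h0] with z hz hz0
    exact fderiv.log (hz.differentiableAt (by simp)) hz0
  have h2 : HasFDerivAt (fun x ↦ (f x)⁻¹ • fderiv ℝ f x) _ x :=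
    ((hasDerivAt_inv h0).comp_hasFDerivAt x (hf.differentiableAt (by simp)).hasFDerivAt).smul
      ((hf.fderiv_right (m := 1) (by norm_num)).differentiableAt (by simp)).hasFDerivAt
  ext u v
  rw [hessian_apply, h1.fderiv_eq, h2.fderiv, fderiv_log hf h0]
  simp only [add_apply, sub_apply, smul_apply, smul_eq_mul, ContinuousLinearMap.smulRight_apply,
    hessian_apply, Function.comp_apply]
  ring

theorem laplacian_log [FiniteDimensional ℝ E] (hf : ContDiffAt ℝ 2 f x) (h0 : f x ≠ 0) :
    laplacian G (fun x ↦ Real.log (f x)) x =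
      laplacian G f x / f x - fderiv ℝ f x (gradient G f x) / f x ^ 2 := by
  have h1 : (((G x).inverse ∘L hessian G (fun x ↦ Real.log (f x)) x : E →L[ℝ] E) : E →ₗ[ℝ] E) =
      (f x)⁻¹ • (((G x).inverse ∘L hessian G f x : E →L[ℝ] E) : E →ₗ[ℝ] E) -
      (f x ^ 2)⁻¹ • (fderiv ℝ f x : E →ₗ[ℝ] ℝ).smulRight (gradient G f x) := by
    ext v
    simp [hessian_log hf h0, gradient]
  rw [laplacian, h1, map_sub, map_smul, map_smul, LinearMap.trace_smulRight, laplacian]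
  simp only [smul_eq_mul, ContinuousLinearMap.coe_coe]
  ring

end Logarithm

variable {E' : Type*} [NormedAddCommGroup E'] [NormedSpace ℝ E']
  [FiniteDimensional ℝ E] [FiniteDimensional ℝ E']
  {GB : E → E →L[ℝ] E →L[ℝ] ℝ} {GF : E' → E' →L[ℝ] E' →L[ℝ] ℝ} {φ ψ : E → ℝ} {x : E} {y : E'}

/-- In the coefficient of each of H^φ, dφ ⊗ dφ and |∇φ|² g_B, the identity contributes the dimension
of the base and rank-one maps take away 2, up to a common sign. -/
theorem WarpedRegularAt.ricci_base_base (h : WarpedRegularAt GB GF φ ψ x y) (v w : E) :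
    ricci (warped GB GF φ ψ) (x, y) (v, 0) (w, 0) =
      ricci GB x v w -
      (Module.finrank ℝ E - 2) * (hessian GB φ x v w - fderiv ℝ φ x v * fderiv ℝ φ x w) -
      (laplacian GB φ x + (Module.finrank ℝ E - 2) * fderiv ℝ φ x (gradient GB φ x)) * GB x v w +
      Module.finrank ℝ E' * (fderiv ℝ ψ x v * fderiv ℝ φ x w + fderiv ℝ φ x v * fderiv ℝ ψ x w -
        GB x v w * fderiv ℝ ψ x (gradient GB φ x) - hessian GB ψ x v w -
        fderiv ℝ ψ x v * fderiv ℝ ψ x w) := by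
  have sG := h.base.symm.self_of_nhds
  have hB : ((ContinuousLinearMap.fst ℝ E E' ∘L curvature (warped GB GF φ ψ) (x, y) (v, 0) (w, 0) ∘L
      ContinuousLinearMap.inl ℝ E E' : E →L[ℝ] E) : E →ₗ[ℝ] E) =
      (curvature GB x v w : E →ₗ[ℝ] E) +
      ((hessian GB φ x w - fderiv ℝ φ x w • fderiv ℝ φ x +
        fderiv ℝ φ x (gradient GB φ x) • GB x w : E →L[ℝ] ℝ) : E →ₗ[ℝ] ℝ).smulRight v -
      (hessian GB φ x v w - fderiv ℝ φ x v * fderiv ℝ φ x w +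
        fderiv ℝ φ x (gradient GB φ x) * GB x v w) • LinearMap.id -
      GB x v w • (((GB x).inverse ∘L hessian GB φ x : E →L[ℝ] E) : E →ₗ[ℝ] E) +
      (GB x w : E →ₗ[ℝ] ℝ).smulRight ((GB x).inverse (hessian GB φ x v)) +
      ((GB x v w • fderiv ℝ φ x - fderiv ℝ φ x v • GB x w : E →L[ℝ] ℝ) : E →ₗ[ℝ] ℝ).smulRight
        (gradient GB φ x) :=
    LinearMap.ext fun a ↦ h.curvature_base_base_fst a v w
  have hF : ((ContinuousLinearMap.snd ℝ E E' ∘L curvature (warped GB GF φ ψ) (x, y) (v, 0) (w, 0) ∘L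
      ContinuousLinearMap.inr ℝ E E' : E' →L[ℝ] E') : E' →ₗ[ℝ] E') =
      (fderiv ℝ ψ x v * fderiv ℝ φ x w + fderiv ℝ φ x v * fderiv ℝ ψ x w -
        GB x v w * fderiv ℝ ψ x (gradient GB φ x) - hessian GB ψ x v w -
        fderiv ℝ ψ x v * fderiv ℝ ψ x w) • LinearMap.id :=
    LinearMap.ext fun t ↦ h.curvature_base_base_snd t v w
  rw [ricci, trace_prod, hB, hF]
  simp only [map_add, map_sub, map_smul, LinearMap.trace_smulRight, LinearMap.trace_id,
    ContinuousLinearMap.coe_coe, add_apply, sub_apply, smul_apply, smul_eq_mul]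
  rw [ricci, laplacian, sG w (gradient GB φ x), sG w ((GB x).inverse _),
    h.base.isInvertible.self_apply_inverse, inner_gradient h.base.isInvertible,
    h.base.hessian_symm h.conformal w v, sG w v]
  ring

theorem WarpedRegularAt.ricci_base_fiber (h : WarpedRegularAt GB GF φ ψ x y) (v : E) (w : E') :
    ricci (warped GB GF φ ψ) (x, y) (v, 0) (0, w) = 0 := by
  have hB : ((ContinuousLinearMap.fst ℝ E E' ∘L curvature (warped GB GF φ ψ) (x, y) (v, 0) (0, w) ∘L
      ContinuousLinearMap.inl ℝ E E' : E →L[ℝ] E) : E →ₗ[ℝ] E) = 0 :=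
    LinearMap.ext fun a ↦ h.curvature_base_fiber_fst a v w
  have hF : ((ContinuousLinearMap.snd ℝ E E' ∘L curvature (warped GB GF φ ψ) (x, y) (v, 0) (0, w) ∘L
      ContinuousLinearMap.inr ℝ E E' : E' →L[ℝ] E') : E' →ₗ[ℝ] E') = 0 :=
    LinearMap.ext fun t ↦ h.curvature_base_fiber_snd t v w
  rw [ricci, trace_prod, hB, hF, map_zero, map_zero, add_zero]

theorem WarpedRegularAt.ricci_fiber_base (h : WarpedRegularAt GB GF φ ψ x y) (v : E') (w : E) :
    ricci (warped GB GF φ ψ) (x, y) (0, v) (w, 0) = 0 := by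
  have hB : ((ContinuousLinearMap.fst ℝ E E' ∘L curvature (warped GB GF φ ψ) (x, y) (0, v) (w, 0) ∘L
      ContinuousLinearMap.inl ℝ E E' : E →L[ℝ] E) : E →ₗ[ℝ] E) = 0 :=
    LinearMap.ext fun a ↦ h.curvature_fiber_base_fst a w v
  have hF : ((ContinuousLinearMap.snd ℝ E E' ∘L curvature (warped GB GF φ ψ) (x, y) (0, v) (w, 0) ∘L
      ContinuousLinearMap.inr ℝ E E' : E' →L[ℝ] E') : E' →ₗ[ℝ] E') = 0 :=
    LinearMap.ext fun t ↦ h.curvature_fiber_base_snd t w v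
  rw [ricci, trace_prod, hB, hF, map_zero, map_zero, add_zero]

/-- The coefficient k of |∇ψ|² is k - 1 from the fiber block plus 1 from the rank-one term dψ ⊗ ∇ψ
of the base block. -/
theorem WarpedRegularAt.ricci_fiber_fiber (h : WarpedRegularAt GB GF φ ψ x y) (v w : E') :
    ricci (warped GB GF φ ψ) (x, y) (0, v) (0, w) =
      ricci GF y v w - Real.exp (2 * ψ x - 2 * φ x) *
        (laplacian GB ψ x + (Module.finrank ℝ E - 2) * fderiv ℝ φ x (gradient GB ψ x) +
          Module.finrank ℝ E' * fderiv ℝ ψ x (gradient GB ψ x)) * GF y v w := by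
  have sG := h.base.symm.self_of_nhds
  have hPQ : fderiv ℝ ψ x (gradient GB φ x) = fderiv ℝ φ x (gradient GB ψ x) := by
    rw [← inner_gradient h.base.isInvertible, sG, inner_gradient h.base.isInvertible]
  have hB : ((ContinuousLinearMap.fst ℝ E E' ∘L curvature (warped GB GF φ ψ) (x, y) (0, v) (0, w) ∘L
      ContinuousLinearMap.inl ℝ E E' : E →L[ℝ] E) : E →ₗ[ℝ] E) =
      -(Real.exp (2 * ψ x - 2 * φ x) * GF y v w) •
        (((fderiv ℝ ψ x - fderiv ℝ φ x : E →L[ℝ] ℝ) : E →ₗ[ℝ] ℝ).smulRight (gradient GB ψ x) +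
          (((GB x).inverse ∘L hessian GB ψ x : E →L[ℝ] E) : E →ₗ[ℝ] E) +
          fderiv ℝ φ x (gradient GB ψ x) • LinearMap.id -
          (fderiv ℝ ψ x : E →ₗ[ℝ] ℝ).smulRight (gradient GB φ x)) :=
    LinearMap.ext fun a ↦ h.curvature_fiber_fiber_fst a v w
  have hF : ((ContinuousLinearMap.snd ℝ E E' ∘L curvature (warped GB GF φ ψ) (x, y) (0, v) (0, w) ∘L
      ContinuousLinearMap.inr ℝ E E' : E' →L[ℝ] E') : E' →ₗ[ℝ] E') =
      (curvature GF y v w : E' →ₗ[ℝ] E') -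
      (Real.exp (2 * ψ x - 2 * φ x) * fderiv ℝ ψ x (gradient GB ψ x)) •
        (GF y v w • LinearMap.id - (GF y w : E' →ₗ[ℝ] ℝ).smulRight v) :=
    LinearMap.ext fun t ↦ h.curvature_fiber_fiber_snd t v w
  rw [ricci, trace_prod, hB, hF]
  simp only [map_add, map_sub, map_smul, LinearMap.trace_smulRight, LinearMap.trace_id,
    ContinuousLinearMap.coe_coe, sub_apply, smul_eq_mul]
  rw [ricci, laplacian, hPQ, h.fiber.symm.self_of_nhds w v]
  ring

/-- Needed because chart coefficients agree with a warped metric only near the point. -/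
theorem ricci_congr {E : Type*} [NormedAddCommGroup E] [NormedSpace ℝ E]
    {G G' : E → E →L[ℝ] E →L[ℝ] ℝ} {x : E} (h : G =ᶠ[𝓝 x] G') : ricci G x = ricci G' x := by
  have h1 : christoffel G =ᶠ[𝓝 x] christoffel G' := by
    filter_upwards [h, h.fderiv (𝕜 := ℝ)] with z hz hz'
    rw [christoffel, christoffel, koszul, koszul, hz, hz']
  funext v w
  rw [ricci, ricci, curvature, curvature, h1.fderiv_eq, h1.self_of_nhds]

section Positive

variable {C W : E → ℝ}

/-- Since H^{log c} = H^c/c - dc ⊗ dc/c², the coefficient of dc ⊗ dc doubles to 2(m - 2), the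
Laplacian lowers m - 2 to m - 3, and the dw ⊗ dw terms cancel. -/
theorem ricci_warped_log_base_base (hB : RegularAt GB x) (hF : RegularAt GF y)
    (hC : ContDiffAt ℝ 2 C x) (hW : ContDiffAt ℝ 2 W x) (hC0 : 0 < C x) (hW0 : 0 < W x) (v w : E) :
    ricci (warped GB GF (fun x ↦ Real.log (C x)) (fun x ↦ Real.log (W x))) (x, y) (v, 0) (w, 0) =
      ricci GB x v w
      - ((Module.finrank ℝ E - 2) * (1 / C x) * hessian GB C x v w
        + Module.finrank ℝ E' * (1 / W x) * hessian GB W x v w)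
      + 2 * (Module.finrank ℝ E - 2) * (1 / C x ^ 2) * (fderiv ℝ C x v * fderiv ℝ C x w)
      + Module.finrank ℝ E' * (1 / (W x * C x)) *
        (fderiv ℝ C x v * fderiv ℝ W x w + fderiv ℝ W x v * fderiv ℝ C x w)
      - ((Module.finrank ℝ E - 3) * (GB x (gradient GB C x) (gradient GB C x) / C x ^ 2)
          + laplacian GB C x / C x
          + Module.finrank ℝ E' * (GB x (gradient GB W x) (gradient GB C x) / (W x * C x)))
        * GB x v w := by
  rw [(WarpedRegularAt.of_pos hB hF hC hW hC0 hW0).ricci_base_base]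
  simp only [fderiv_log hC hC0.ne', fderiv_log hW hW0.ne', hessian_log hC hC0.ne',
    hessian_log hW hW0.ne', gradient_log hC hC0.ne', laplacian_log hC hC0.ne',
    inner_gradient hB.isInvertible, map_smul, smul_eq_mul, sub_apply, smul_apply,
    ContinuousLinearMap.smulRight_apply]
  field_simp
  ring

/-- The Laplacian of log w contributes -|∇w|²/w², which lowers k to k - 1. -/
theorem ricci_warped_log_fiber_fiber (hB : RegularAt GB x) (hF : RegularAt GF y)
    (hC : ContDiffAt ℝ 2 C x) (hW : ContDiffAt ℝ 2 W x) (hC0 : 0 < C x) (hW0 : 0 < W x)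
    (v w : E') :
    ricci (warped GB GF (fun x ↦ Real.log (C x)) (fun x ↦ Real.log (W x))) (x, y) (0, v) (0, w) =
      ricci GF y v w
      - W x ^ 2 / C x ^ 2 *
        ((Module.finrank ℝ E - 2) * (GB x (gradient GB W x) (gradient GB C x) / (W x * C x))
          + laplacian GB W x / W x
          + (Module.finrank ℝ E' - 1) *
            (GB x (gradient GB W x) (gradient GB W x) / W x ^ 2))
        * GF y v w := by
  have hexp : Real.exp (2 * Real.log (W x) - 2 * Real.log (C x)) = W x ^ 2 / C x ^ 2 := by
    rw [Real.exp_sub, two_mul, two_mul, Real.exp_add, Real.exp_add, Real.exp_log hC0,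
      Real.exp_log hW0, sq, sq]
  rw [(WarpedRegularAt.of_pos hB hF hC hW hC0 hW0).ricci_fiber_fiber, hexp,
    hB.symm.self_of_nhds (gradient GB W x) (gradient GB C x)]
  simp only [fderiv_log hC hC0.ne', fderiv_log hW hW0.ne', gradient_log hW hW0.ne',
    laplacian_log hW hW0.ne', inner_gradient hB.isInvertible, map_smul, smul_eq_mul]
  field_simp
  ring

end Positive

end

end LocalMetric

namespace PseudoRiemannianMetric

open Filter Topology

/-! ### Metric, gradient and differential in the preferred chart. -/

section Chart

variable {E : Type*} [NormedAddCommGroup E] [NormedSpace ℝ E]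
  {H : Type*} [TopologicalSpace H] {I : ModelWithCorners ℝ E H}
  {M : Type*} [TopologicalSpace M] [ChartedSpace H M]

theorem mvfderiv_eq_fderiv {f : M → ℝ} [I.Boundaryless] (hf : ContMDiff I 𝓘(ℝ, ℝ) ∞ f) (p : M) :
    mvfderiv I f p = fderiv ℝ (f ∘ (extChartAt I p).symm) (extChartAt I p p) := by
  have h : MDifferentiableAt I 𝓘(ℝ, ℝ) f p := (hf p).mdifferentiableAt (by simp)
  ext v
  change mfderiv I 𝓘(ℝ, ℝ) f p v = _
  rw [h.mfderiv, I.range_eq_univ, fderivWithin_univ]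
  rfl

variable [IsManifold I ∞ M]

theorem inChart_apply (g : PseudoRiemannianMetric I M) (p : M) (y u v : E) :
    g.inChart p y u v = g.inner ((extChartAt I p).symm y)
      (mfderivWithin 𝓘(ℝ, E) I (extChartAt I p).symm (Set.range I) y u)
      (mfderivWithin 𝓘(ℝ, E) I (extChartAt I p).symm (Set.range I) y v) := rfl

/-- The preferred chart is the one that identifies the tangent space at p with E, so its inverse has
identity derivative at the center. -/
theorem inChart_self (g : PseudoRiemannianMetric I M) (p : M) :
    g.inChart p (extChartAt I p p) = g.inner p := by
  have : IsManifold I 1 M := IsManifold.of_le (n := ∞) (by simp)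
  let A : M → E →L[ℝ] E →L[ℝ] ℝ := g.inner
  have h1 : A ((extChartAt I p).symm (extChartAt I p p)) = A p :=
    congrArg A ((extChartAt I p).left_inv (mem_extChartAt_source p))
  let D : E → E →L[ℝ] E := mfderivWithin 𝓘(ℝ, E) I (extChartAt I p).symm (Set.range I)
  have h2 : D (extChartAt I p p) = ContinuousLinearMap.id ℝ E := mfderivWithin_range_extChartAt_symm
  change pullbackForm (A _) (D _) = A p
  rw [h1, h2]
  rfl

/-- Smoothness of g is a statement about trivializations; this carries it over to the chart
coefficients. -/
theorem inChart_eventuallyEq (g : PseudoRiemannianMetric I M) [I.Boundaryless] (p : M) :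
    g.inChart p =ᶠ[𝓝 (extChartAt I p p)] fun y ↦
      ContinuousLinearMap.inCoordinates E (fun x : M ↦ TangentSpace I x)
        (E →L[ℝ] ℝ) (fun x : M ↦ TangentSpace I x →L[ℝ] ℝ) p ((extChartAt I p).symm y) p
        ((extChartAt I p).symm y) (g.inner ((extChartAt I p).symm y)) := by
  have : IsManifold I 1 M := IsManifold.of_le (n := ∞) (by simp)
  filter_upwards [extChartAt_target_mem_nhds (I := I) p] with y hy
  have hs : (extChartAt I p).symm y ∈ (chartAt H p).source := by
    rw [← extChartAt_source I]
    exact (extChartAt I p).map_target hy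
  have hb : (extChartAt I p).symm y ∈
      (trivializationAt E (fun x : M ↦ TangentSpace I x) p).baseSet := hs
  let D : E → E →L[ℝ] E := mfderivWithin 𝓘(ℝ, E) I (extChartAt I p).symm (Set.range I)
  have hD : ∀ u : E, (trivializationAt E (fun x : M ↦ TangentSpace I x) p).symmL ℝ
      ((extChartAt I p).symm y) u = D y u := by
    intro u
    rw [TangentBundle.symmL_trivializationAt hs]
    exact congrArg (fun z ↦ D z u) ((extChartAt I p).right_inv hy)
  ext u v
  rw [inChart_apply, ContinuousLinearMap.inCoordinates, ContinuousLinearMap.comp_apply,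
    ContinuousLinearMap.comp_apply, hom_real_trivialization_apply hb, hD, hD]
  rfl

theorem contDiffAt_inChart (g : PseudoRiemannianMetric I M) [I.Boundaryless] (p : M) :
    ContDiffAt ℝ ∞ (g.inChart p) (extChartAt I p p) := by
  refine ContDiffAt.congr_of_eventuallyEq ?_ (g.inChart_eventuallyEq p)
  have h1 := ((contMDiffAt_hom_bundle _).1 (g.contMDiff p)).2
  have h2 : ContMDiffAt 𝓘(ℝ, E) I ∞ (extChartAt I p).symm (extChartAt I p p) :=
    (contMDiffOn_extChartAt_symm p).contMDiffAt (extChartAt_target_mem_nhds p)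
  have h3 : ContMDiffAt I 𝓘(ℝ, E →L[ℝ] E →L[ℝ] ℝ) ∞ (fun x ↦
      ContinuousLinearMap.inCoordinates E (fun x : M ↦ TangentSpace I x)
        (E →L[ℝ] ℝ) (fun x : M ↦ TangentSpace I x →L[ℝ] ℝ) p x p x (g.inner x))
      ((extChartAt I p).symm (extChartAt I p p)) := by
    rw [(extChartAt I p).left_inv (mem_extChartAt_source p)]
    exact h1
  exact (h3.comp _ h2).contDiffAt

theorem regularAt_inChart [FiniteDimensional ℝ E] (g : PseudoRiemannianMetric I M) [I.Boundaryless]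
    (p : M) : LocalMetric.RegularAt (g.inChart p) (extChartAt I p p) where
  contDiffAt := (g.contDiffAt_inChart p).of_le (WithTop.coe_le_coe.2 le_top)
  symm := Eventually.of_forall fun y u v ↦ g.symm _ _ _
  isInvertible := by
    rw [g.inChart_self p]
    exact LocalMetric.isInvertible_of_nondegenerate (E := E) (g.inner p) (g.nondegenerate p)

variable {f : M → ℝ}

theorem contDiffAt_comp_extChartAt_symm [I.Boundaryless] (hf : ContMDiff I 𝓘(ℝ, ℝ) ∞ f) (p : M) :
    ContDiffAt ℝ 2 (f ∘ (extChartAt I p).symm) (extChartAt I p p) := by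
  have h2 : ContMDiffAt 𝓘(ℝ, E) I ∞ (extChartAt I p).symm (extChartAt I p p) :=
    (contMDiffOn_extChartAt_symm p).contMDiffAt (extChartAt_target_mem_nhds p)
  exact ((hf _).comp _ h2).contDiffAt.of_le (WithTop.coe_le_coe.2 le_top)

theorem gradient_eq_local [I.Boundaryless] (g : PseudoRiemannianMetric I M)
    (hf : ContMDiff I 𝓘(ℝ, ℝ) ∞ f) (p : M) :
    g.gradient f p = LocalMetric.gradient (g.inChart p) (f ∘ (extChartAt I p).symm)
      (extChartAt I p p) := by
  rw [gradient, mvfderiv_eq_fderiv hf, LocalMetric.gradient, inChart_self]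
  rfl

end Chart

/-! ### Product charts. -/

section Product

variable {E : Type*} [NormedAddCommGroup E] [NormedSpace ℝ E]
  {H : Type*} [TopologicalSpace H] {I : ModelWithCorners ℝ E H}
  {B : Type*} [TopologicalSpace B] [ChartedSpace H B]
  {E' : Type*} [NormedAddCommGroup E'] [NormedSpace ℝ E']
  {H' : Type*} [TopologicalSpace H'] {I' : ModelWithCorners ℝ E' H'}
  {F : Type*} [TopologicalSpace F] [ChartedSpace H' F]

/-- The inverse product chart commutes with the projection; apply the chain rule to both composites.
-/
theorem mfderiv_fst_extChartAt_symm [IsManifold I 1 B] [IsManifold I' 1 F] [I.Boundaryless]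
    [I'.Boundaryless] {p : B} {q : F} {z : E × E'}
    (h1 : z.1 ∈ (extChartAt I p).target) (h2 : z.2 ∈ (extChartAt I' q).target) (u : E × E') :
    (mfderivWithin 𝓘(ℝ, E × E') (I.prod I') (extChartAt (I.prod I') (p, q)).symm
      (Set.range (I.prod I')) z u : E × E').1 =
      mfderivWithin 𝓘(ℝ, E) I (extChartAt I p).symm (Set.range I) z.1 u.1 := by
  have hz : z ∈ (extChartAt (I.prod I') (p, q)).target := by
    rw [extChartAt_prod]
    exact ⟨h1, h2⟩
  have d1 := mdifferentiableWithinAt_extChartAt_symm hz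
  have d2 := mdifferentiableWithinAt_extChartAt_symm h1
  rw [ModelWithCorners.range_eq_univ] at d1 d2 ⊢
  rw [ModelWithCorners.range_eq_univ, mfderivWithin_univ, mfderivWithin_univ]
  rw [mdifferentiableWithinAt_univ] at d1 d2
  have c1 := mfderiv_comp z (mdifferentiableAt_fst (I := I) (I' := I')) d1
  have d3 : MDifferentiableAt 𝓘(ℝ, E × E') 𝓘(ℝ, E) (Prod.fst : E × E' → E) z :=
    differentiableAt_fst.mdifferentiableAt
  have c2 := mfderiv_comp z d2 d3
  have hc : (Prod.fst : B × F → B) ∘ (extChartAt (I.prod I') (p, q)).symm =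
      (extChartAt I p).symm ∘ (Prod.fst : E × E' → E) := by
    rw [extChartAt_prod]
    rfl
  rw [hc, c2, mfderiv_fst, mfderiv_eq_fderiv, fderiv_fst] at c1
  exact (congrArg (fun L : E × E' →L[ℝ] E ↦ L u) c1).symm

theorem mfderiv_snd_extChartAt_symm [IsManifold I 1 B] [IsManifold I' 1 F] [I.Boundaryless]
    [I'.Boundaryless] {p : B} {q : F} {z : E × E'}
    (h1 : z.1 ∈ (extChartAt I p).target) (h2 : z.2 ∈ (extChartAt I' q).target) (u : E × E') :
    (mfderivWithin 𝓘(ℝ, E × E') (I.prod I') (extChartAt (I.prod I') (p, q)).symm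
      (Set.range (I.prod I')) z u : E × E').2 =
      mfderivWithin 𝓘(ℝ, E') I' (extChartAt I' q).symm (Set.range I') z.2 u.2 := by
  have hz : z ∈ (extChartAt (I.prod I') (p, q)).target := by
    rw [extChartAt_prod]
    exact ⟨h1, h2⟩
  have d1 := mdifferentiableWithinAt_extChartAt_symm hz
  have d2 := mdifferentiableWithinAt_extChartAt_symm h2
  rw [ModelWithCorners.range_eq_univ] at d1 d2 ⊢
  rw [ModelWithCorners.range_eq_univ, mfderivWithin_univ, mfderivWithin_univ]
  rw [mdifferentiableWithinAt_univ] at d1 d2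
  have c1 := mfderiv_comp z (mdifferentiableAt_snd (I := I) (I' := I')) d1
  have d3 : MDifferentiableAt 𝓘(ℝ, E × E') 𝓘(ℝ, E') (Prod.snd : E × E' → E') z :=
    differentiableAt_snd.mdifferentiableAt
  have c2 := mfderiv_comp z d2 d3
  have hc : (Prod.snd : B × F → F) ∘ (extChartAt (I.prod I') (p, q)).symm =
      (extChartAt I' q).symm ∘ (Prod.snd : E × E' → E') := by
    rw [extChartAt_prod]
    rfl
  rw [hc, c2, mfderiv_snd, mfderiv_eq_fderiv, fderiv_snd] at c1
  exact (congrArg (fun L : E × E' →L[ℝ] E' ↦ L u) c1).symm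

variable [IsManifold I ∞ B] [IsManifold I' ∞ F] [I.Boundaryless] [I'.Boundaryless]
  (gB : PseudoRiemannianMetric I B) (gF : PseudoRiemannianMetric I' F) {c w : B → ℝ}
  (hc : ContMDiff I 𝓘(ℝ, ℝ) ∞ c) (hw : ContMDiff I 𝓘(ℝ, ℝ) ∞ w)
  (hc_pos : ∀ x, 0 < c x) (hw_pos : ∀ x, 0 < w x)

/-- In a product chart a base conformal warped product is a warped metric. -/
theorem inChart_baseConformalWarped (p : B) (q : F) :
    (gB.baseConformalWarped gF c w hc hw hc_pos hw_pos).inChart (p, q)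
      =ᶠ[𝓝 (extChartAt I p p, extChartAt I' q q)]
      LocalMetric.warped (gB.inChart p) (gF.inChart q)
        (fun x ↦ Real.log ((c ∘ (extChartAt I p).symm) x))
        (fun x ↦ Real.log ((w ∘ (extChartAt I p).symm) x)) := by
  have : IsManifold I 1 B := IsManifold.of_le (n := ∞) (by simp)
  have : IsManifold I' 1 F := IsManifold.of_le (n := ∞) (by simp)
  rw [nhds_prod_eq]
  filter_upwards [(show ∀ᶠ y in 𝓝 (extChartAt I p p), y ∈ (extChartAt I p).target from
    extChartAt_target_mem_nhds p).prod_mk (show ∀ᶠ y in 𝓝 (extChartAt I' q q),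
    y ∈ (extChartAt I' q).target from extChartAt_target_mem_nhds q)] with z hz
  have hexp : ∀ r : ℝ, 0 < r → Real.exp (2 * Real.log r) = r ^ 2 := by
    intro r hr
    rw [two_mul, Real.exp_add, Real.exp_log hr, sq]
  have hsymm : (extChartAt (I.prod I') (p, q)).symm z =
      ((extChartAt I p).symm z.1, (extChartAt I' q).symm z.2) := by
    rw [extChartAt_prod]
    rfl
  have key : ∀ (s : B × F) (a b : E × E'),
      (gB.baseConformalWarped gF c w hc hw hc_pos hw_pos).inner s a b =
        c s.1 ^ 2 * gB.inner s.1 a.1 b.1 + w s.1 ^ 2 * gF.inner s.2 a.2 b.2 := by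
    intro s a b
    change c s.1 ^ 2 * gB.inner s.1 (mfderiv (I.prod I') I Prod.fst s a)
      (mfderiv (I.prod I') I Prod.fst s b) + w s.1 ^ 2 * gF.inner s.2
      (mfderiv (I.prod I') I' Prod.snd s a) (mfderiv (I.prod I') I' Prod.snd s b) = _
    rw [mfderiv_fst, mfderiv_snd]
    rfl
  refine ContinuousLinearMap.ext fun u ↦ ContinuousLinearMap.ext fun v ↦ ?_
  rw [LocalMetric.warped_apply, inChart_apply, inChart_apply, inChart_apply,
    ← mfderiv_fst_extChartAt_symm hz.1 hz.2, ← mfderiv_fst_extChartAt_symm hz.1 hz.2,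
    ← mfderiv_snd_extChartAt_symm hz.1 hz.2, ← mfderiv_snd_extChartAt_symm hz.1 hz.2,
    hexp ((c ∘ (extChartAt I p).symm) z.1) (hc_pos _),
    hexp ((w ∘ (extChartAt I p).symm) z.1) (hw_pos _)]
  refine (key _ _ _).trans ?_
  rw [hsymm]
  rfl

end Product

end PseudoRiemannianMetric

end

theorem mainTheorem5 {m k : ℕ}
    {B : Type*} [TopologicalSpace B] [ChartedSpace (EuclideanSpace ℝ (Fin m)) B]
    [IsManifold (𝓡 m) ∞ B]
    {F : Type*} [TopologicalSpace F] [ChartedSpace (EuclideanSpace ℝ (Fin k)) F]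
    [IsManifold (𝓡 k) ∞ F]
    (gB : PseudoRiemannianMetric (𝓡 m) B) (gF : PseudoRiemannianMetric (𝓡 k) F)
    (c w : B → ℝ) (hc : ContMDiff (𝓡 m) 𝓘(ℝ, ℝ) ∞ c) (hw : ContMDiff (𝓡 m) 𝓘(ℝ, ℝ) ∞ w)
    (hc_pos : ∀ x, 0 < c x) (hw_pos : ∀ x, 0 < w x)
    (g : PseudoRiemannianMetric ((𝓡 m).prod (𝓡 k)) (B × F))
    (hg : g = gB.baseConformalWarped gF c w hc hw hc_pos hw_pos) :
    (∀ (X Y : ∀ x : B, TangentSpace (𝓡 m) x) (p : B) (q : F),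
      g.ricci (p, q) (liftBase X (p, q)) (liftBase Y (p, q)) =
        gB.ricci p (X p) (Y p)
        - (((m : ℝ) - 2) * (1 / c p) * gB.hessian c p (X p) (Y p)
          + (k : ℝ) * (1 / w p) * gB.hessian w p (X p) (Y p))
        + 2 * ((m : ℝ) - 2) * (1 / c p ^ 2) *
          (mvfderiv (𝓡 m) c p (X p) * mvfderiv (𝓡 m) c p (Y p))
        + (k : ℝ) * (1 / (w p * c p)) *
          (mvfderiv (𝓡 m) c p (X p) * mvfderiv (𝓡 m) w p (Y p)
            + mvfderiv (𝓡 m) w p (X p) * mvfderiv (𝓡 m) c p (Y p))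
        - (((m : ℝ) - 3) * (gB.inner p (gB.gradient c p) (gB.gradient c p) / c p ^ 2)
            + gB.laplacian c p / c p
            + (k : ℝ) * (gB.inner p (gB.gradient w p) (gB.gradient c p) / (w p * c p)))
          * gB.inner p (X p) (Y p)) ∧
    (∀ (X : ∀ x : B, TangentSpace (𝓡 m) x) (V : ∀ y : F, TangentSpace (𝓡 k) y) (p : B) (q : F),
      g.ricci (p, q) (liftBase X (p, q)) (liftFiber V (p, q)) = 0 ∧
      g.ricci (p, q) (liftFiber V (p, q)) (liftBase X (p, q)) = 0) ∧
    (∀ (V W : ∀ y : F, TangentSpace (𝓡 k) y) (p : B) (q : F),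
      g.ricci (p, q) (liftFiber V (p, q)) (liftFiber W (p, q)) =
        gF.ricci q (V q) (W q)
        - w p ^ 2 / c p ^ 2 *
          (((m : ℝ) - 2) * (gB.inner p (gB.gradient w p) (gB.gradient c p) / (w p * c p))
            + gB.laplacian w p / w p
            + ((k : ℝ) - 1) * (gB.inner p (gB.gradient w p) (gB.gradient w p) / w p ^ 2))
          * gF.inner q (V q) (W q)) := by
  
  subst hg
  have hB := fun p ↦ gB.regularAt_inChart p
  have hF := fun q ↦ gF.regularAt_inChart q
  have hC := fun p ↦ PseudoRiemannianMetric.contDiffAt_comp_extChartAt_symm hc p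
  have hW := fun p ↦ PseudoRiemannianMetric.contDiffAt_comp_extChartAt_symm hw p
  have hself : ∀ (f : B → ℝ) (p : B),
      (f ∘ (extChartAt (𝓡 m) p).symm) (extChartAt (𝓡 m) p p) = f p := fun f p ↦
    congrArg f ((extChartAt (𝓡 m) p).left_inv (mem_extChartAt_source p))
  have hC0 : ∀ p, 0 < (c ∘ (extChartAt (𝓡 m) p).symm) (extChartAt (𝓡 m) p p) := fun p ↦ hc_pos _
  have hW0 : ∀ p, 0 < (w ∘ (extChartAt (𝓡 m) p).symm) (extChartAt (𝓡 m) p p) := fun p ↦ hw_pos _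
  -- The Ricci tensor is pointwise in its arguments, so only the values of the lifted fields at (p,
  -- q) enter below.
  have hric := fun p q ↦ LocalMetric.ricci_congr
    (PseudoRiemannianMetric.inChart_baseConformalWarped gB gF hc hw hc_pos hw_pos p q)
  refine ⟨fun X Y p q ↦ ?_, fun X V p q ↦ ⟨?_, ?_⟩, fun V W p q ↦ ?_⟩
  · have h := LocalMetric.ricci_warped_log_base_base (hB p) (hF q) (hC p) (hW p) (hC0 p) (hW0 p)
      (X p) (Y p)
    rw [← hric, hself, hself, finrank_euclideanSpace_fin, finrank_euclideanSpace_fin,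
      ← gB.gradient_eq_local hc, ← gB.gradient_eq_local hw, gB.inChart_self,
      ← PseudoRiemannianMetric.mvfderiv_eq_fderiv hc,
      ← PseudoRiemannianMetric.mvfderiv_eq_fderiv hw] at h
    exact h
  · have h := (LocalMetric.WarpedRegularAt.of_pos (hB p) (hF q) (hC p) (hW p) (hC0 p)
      (hW0 p)).ricci_base_fiber (X p) (V q)
    rw [← hric] at h
    exact h
  · have h := (LocalMetric.WarpedRegularAt.of_pos (hB p) (hF q) (hC p) (hW p) (hC0 p)
      (hW0 p)).ricci_fiber_base (V q) (X p)
    rw [← hric] at h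
    exact h
  · have h := LocalMetric.ricci_warped_log_fiber_fiber (hB p) (hF q) (hC p) (hW p) (hC0 p) (hW0 p)
      (V q) (W q)
    rw [← hric, hself, hself, finrank_euclideanSpace_fin, finrank_euclideanSpace_fin,
      ← gB.gradient_eq_local hc, ← gB.gradient_eq_local hw, gB.inChart_self, gF.inChart_self] at h
    exact h
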